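/- Let $\mathcal O$ be a commutative ring and let $G=\operatorname{Spec} H$ be a generalised torus over $\mathcal O$, i.e. a smooth affine $\mathcal O$-group scheme whose neutral component $G^0$ (the subgroup of points lying fibrewise in the identity component) is a torus, that is, fpqc-locally on $\operatorname{Spec}\mathcal O$ isomorphic to some $\mathbb G_m^n$, and whose component group $G/G^0$ (fpqc quotient) is finite over $\mathcal O$. Let $\Gamma$ be an abstract group. For an $\mathcal O$-algebra $A$ let $\mathrm{Rep}^{\Gamma}_G(A)$ be the set of homomorphisms $\rho:\Gamma\to G(A)$. Let $G^0$ act on $G^n$ by simultaneous conjugation. Let $\mathrm{PC}^{\Gamma}_G(A)$ be the set of $A$-valued $G$-pseudocharacters of $\Gamma$, i.e. of sequences $(\Theta_n)_{n\ge 1}$ of $\mathcal O$-algebra homomorphisms $\Theta_n:\mathcal O[G^n]^{G^0}\to \mathrm{Map}(\Gamma^n,A)$ such that (1) $\Theta_n(f^{\zeta})(\gamma_1,\dots,\gamma_n)=\Theta_m(f)(\gamma_{\zeta(1)},\dots,\gamma_{\zeta(m)})$ for all $m,n\ge 1$, all maps $\zeta:\{1,\dots,m\}\to\{1,\dots,n\}$,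 all $f\in\mathcal O[G^m]^{G^0}$ and $\gamma_i\in\Gamma$, where $f^{\zeta}(g_1,\dots,g_n)=f(g_{\zeta(1)},\dots,g_{\zeta(m)})$; (2) $\Theta_{n+1}(\hat f)(\gamma_1,\dots,\gamma_{n+1})=\Theta_n(f)(\gamma_1,\dots,\gamma_{n-1},\gamma_n\gamma_{n+1})$ for all $n\ge 1$, $f\in\mathcal O[G^n]^{G^0}$ and $\gamma_i\in\Gamma$, where $\hat f(g_1,\dots,g_{n+1})=f(g_1,\dots,g_{n-1},g_ng_{n+1})$. The pseudocharacter $\Theta_\rho$ of $\rho\in\mathrm{Rep}^{\Gamma}_G(A)$ is given by $(\Theta_\rho)_n(f)(\gamma_1,\dots,\gamma_n)=f(\rho(\gamma_1),\dots,\rho(\gamma_n))$. (a) The functors $\mathrm{Rep}^{\Gamma}_G$ and $\mathrm{PC}^{\Gamma}_G$ are representable by affine $\mathcal O$-schemes, and $\rho\mapsto\Theta_\rho$ induces an isomorphism $\mathrm{Rep}^{\Gamma}_G/\!\!/G^0\xrightarrow{\ \cong\ }\mathrm{PC}^{\Gamma}_G$; that is, the induced map of $\mathcal O$-algebras $\mathcal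 O(\mathrm{PC}^{\Gamma}_G)\to\mathcal O(\mathrm{Rep}^{\Gamma}_G)$ is an isomorphism onto the ring of invariants $\mathcal O(\mathrm{Rep}^{\Gamma}_G)^{G^0}$ of the conjugation action. (b) Suppose moreover that $G/G^0$ is the constant group scheme $\underline\Delta$ of a finite group $\Delta$, with quotient map $\Pi:G\to\underline\Delta$, and let $\pi:\Gamma\to\Delta$ be a homomorphism. Call $\rho\in\mathrm{Rep}^{\Gamma}_G(A)$ admissible if $\Pi\circ\rho$ is the composite of $\pi$ with $\Delta\to\underline\Delta(A)$, and call $\Theta\in\mathrm{PC}^{\Gamma}_G(A)$ admissible if its image in $\mathrm{PC}^{\Gamma}_{\underline\Delta}(A)$ under $\Pi$ is the $\underline\Delta$-pseudocharacter attached to $\pi$. The functors $\mathrm{Rep}^{\Gamma}_{G,\pi}$ and $\mathrm{PC}^{\Gamma}_{G,\pi}$ of admissible representations and admissible pseudocharacters are representable by affine $\mathcal O$-schemes, and $\rho\mapsto\Theta_\rho$ induces an isomorphism $\mathrm{Rep}^{\Gamma}_{G,\pi}/\!\!/G^0\xrightarrow{\ \cong\ }\mathrm{PC}^{\Gamma}_{G,\pi}$,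 i.e. an isomorphism $\mathcal O(\mathrm{PC}^{\Gamma}_{G,\pi})\cong\mathcal O(\mathrm{Rep}^{\Gamma}_{G,\pi})^{G^0}$. -/

import Mathlib

open scoped TensorProduct
open WithConv

universe u

namespace GenTorus

noncomputable section

/-! ### Affine group schemes: the group scheme `G = Spec H` is given by its Hopf algebra `H` -/

/-- The group `G(A)` of `A`-points of `G = Spec H` (with the convolution product). -/
abbrev Pt (O H A : Type*) [CommRing O] [CommRing H] [HopfAlgebra O H] [CommRing A] [Algebra O A] :=
  WithConv (H →ₐ[O] A)

section Points

variable {O H H' A B : Type*} [CommRing O] [CommRing H] [HopfAlgebra O H]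
  [CommRing H'] [HopfAlgebra O H'] [CommRing A] [Algebra O A] [CommRing B] [Algebra O B]

instance instGroupPt : Group (Pt O H A) where
  inv f := toConv (f.ofConv.comp (HopfAlgebra.antipodeAlgHom O H))
  inv_mul_cancel f := by
    have h := AlgHom.comp_convMul_distrib f.ofConv
      (toConv (HopfAlgebra.antipodeAlgHom O H)) (toConv (AlgHom.id O H))
    rw [AlgHom.antipode_id_cancel] at h
    apply WithConv.ext
    refine h.symm.trans ?_
    ext x
    simp

/-- The map `G(A) → G(B)` induced by a morphism `A → B`. -/
def Pt.map (φ : A →ₐ[O] B) : Pt O H A →* Pt O H B where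
  toFun g := toConv (φ.comp g.ofConv)
  map_one' := by ext x; simp
  map_mul' f g := WithConv.ext (AlgHom.comp_convMul_distrib φ f g)

/-- The map `G(A) → G'(A)` induced by a morphism of group schemes `G = Spec H → G' = Spec H'`. -/
def Pt.push (p : H' →ₐc[O] H) : Pt O H A →* Pt O H' A where
  toFun g := toConv (g.ofConv.comp (p : H' →ₐ[O] H))
  map_one' := by
    ext x
    simp
  map_mul' f g := WithConv.ext (AlgHom.convMul_comp_bialgHom_distrib f g p)

end Points

/-! ### The neutral component -/

section Neutral

variable (O H : Type u) [CommRing O] [CommRing H] [HopfAlgebra O H]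

/-- The set of points `x` of `G` lying in the connected component of the identity of the fibre of
`G → Spec O` through `x`. -/
def neutralLocus : Set (PrimeSpectrum H) :=
  {x | x ∈ connectedComponentIn
    (PrimeSpectrum.comap (algebraMap O H) ⁻¹' {PrimeSpectrum.comap (algebraMap O H) x})
    (PrimeSpectrum.comap (Bialgebra.counitAlgHom O H).toRingHom
      (PrimeSpectrum.comap (algebraMap O H) x))}

variable {O H} in
/-- `G⁰(A)`: the points `Spec A → G` whose image lies in the neutral locus. -/
def neutralPt (A : Type u) [CommRing A] [Algebra O A] : Set (Pt O H A) :=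
  {g | ∀ t : PrimeSpectrum A, PrimeSpectrum.comap g.ofConv.toRingHom t ∈ neutralLocus O H}

end Neutral

/-! ### Generalised tori -/

section Torus

variable (O : Type u) [CommRing O]

/-- `Spec T` is a torus over `O`: it becomes isomorphic to `𝔾ₘⁿ` (`n` locally constant), as a group
scheme, over an fpqc covering of `Spec O`. -/
def IsTorus (T : Type u) [CommRing T] [HopfAlgebra O T] : Prop :=
  ∃ (k : ℕ) (O' : Fin k → Type u) (_ : ∀ i, CommRing (O' i)) (_ : ∀ i, Algebra O (O' i))
    (n : Fin k → ℕ),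
    (∀ i, Module.Flat O (O' i)) ∧
    (∀ s : PrimeSpectrum O, ∃ i, s ∈ Set.range (PrimeSpectrum.comap (algebraMap O (O' i)))) ∧
    ∀ i, Nonempty (O' i ⊗[O] T ≃ₐc[O' i] AddMonoidAlgebra (O' i) (Fin (n i) → ℤ))

variable {O}

/-- The morphism `G → Spec B` given by `ι` exhibits `Spec B` as the fpqc quotient `G/G⁰`: it is
faithfully flat, and two points of `G` have the same image exactly if they differ by `G⁰`. -/
def IsComponentQuotient {H B : Type u} [CommRing H] [HopfAlgebra O H] [CommRing B] [Algebra O B]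
    (ι : B →ₐ[O] H) : Prop :=
  ι.toRingHom.FaithfullyFlat ∧
  ∀ (A : Type u) [CommRing A] [Algebra O A] (g g' : Pt O H A),
    g.ofConv.comp ι = g'.ofConv.comp ι ↔ g⁻¹ * g' ∈ neutralPt A

variable (O)

/-- `G = Spec H` is a generalised torus: a smooth affine group scheme such that the neutral
component `G⁰` is a torus and the component group `G/G⁰` is finite (it is then finite étale). -/
structure IsGeneralisedTorus (H : Type u) [CommRing H] [HopfAlgebra O H] : Prop where
  smooth : Algebra.Smooth O H
  torus : ∃ (T : Type u) (_ : CommRing T) (_ : HopfAlgebra O T) (q : H →ₐc[O] T), IsTorus O T ∧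
    ∀ (A : Type u) [CommRing A] [Algebra O A],
      Function.Injective (Pt.push q : Pt O T A →* Pt O H A) ∧
      Set.range (Pt.push q : Pt O T A →* Pt O H A) = neutralPt A
  finite_quotient : ∃ (B : Type u) (_ : CommRing B) (_ : Algebra O B) (ι : B →ₐ[O] H),
    Module.Finite O B ∧ IsComponentQuotient ι

end Torus

/-! ### Functions on `Gⁿ` and their `G⁰`-invariants -/

section Functions

variable (O H : Type u) [CommRing O] [CommRing H] [HopfAlgebra O H]

/-- The coordinate ring `𝒪[Gⁿ]`. -/
abbrev Coord (n : ℕ) : Type u := ⨂[O] (_ : Fin n), H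

variable {O H} {A B : Type u} [CommRing A] [Algebra O A] [CommRing B] [Algebra O B]

/-- `evalAt g f = f(g₁, …, gₙ)` for `f ∈ 𝒪[Gⁿ]` and `g₁, …, gₙ ∈ G(A)`. -/
def evalAt {n : ℕ} (g : Fin n → Pt O H A) : Coord O H n →ₐ[O] A :=
  PiTensorProduct.liftAlgHom
    ((MultilinearMap.mkPiAlgebra O (Fin n) A).compLinearMap fun i => (g i).ofConv.toLinearMap)
    (by simp) (fun x y => by simp [Finset.prod_mul_distrib])

/-- The `i`-th coordinate on `Gⁿ`, as a point of `G` with values in `𝒪[Gⁿ]`. -/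
def coordPt {n : ℕ} (i : Fin n) : Pt O H (Coord O H n) :=
  toConv (PiTensorProduct.singleAlgHom (R := O) (A := fun _ : Fin n => H) i)

lemma evalAt_single {n : ℕ} (g : Fin n → Pt O H A) (i : Fin n) :
    (evalAt g).comp (PiTensorProduct.singleAlgHom (R := O) (A := fun _ : Fin n => H) i) =
      (g i).ofConv := by
  ext x
  refine (PiTensorProduct.lift.tprod _).trans ?_
  simp only [MultilinearMap.compLinearMap_apply, MultilinearMap.mkPiAlgebra_apply]
  rw [Finset.prod_eq_single i]
  · simp
  · intro j _ hj
    change (g j).ofConv (Pi.mulSingle (M := fun _ => H) i x j) = 1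
    rw [Pi.mulSingle_eq_of_ne hj, map_one]
  · simp

lemma map_evalAt_coordPt {n : ℕ} (g : Fin n → Pt O H A) (i : Fin n) :
    Pt.map (evalAt g) (coordPt i) = g i :=
  WithConv.ext (evalAt_single g i)

lemma comp_evalAt (φ : A →ₐ[O] B) {n : ℕ} (g : Fin n → Pt O H A) :
    φ.comp (evalAt g) = evalAt fun i => Pt.map φ (g i) := by
  apply PiTensorProduct.algHom_ext
  intro i
  rw [AlgHom.comp_assoc, evalAt_single, evalAt_single]
  rfl

variable (O H) in
/-- `𝒪[Gⁿ]^{G⁰}`: the functions on `Gⁿ` invariant under simultaneous conjugation by `G⁰`. -/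
def invariants (n : ℕ) : Subalgebra O (Coord O H n) where
  carrier := {f | ∀ (A : Type u) [CommRing A] [Algebra O A] (h : Pt O H A), h ∈ neutralPt A →
    ∀ g : Fin n → Pt O H A, evalAt (fun i => h * g i * h⁻¹) f = evalAt g f}
  mul_mem' ha hb A _ _ h hh g := by rw [map_mul, map_mul, ha A h hh g, hb A h hh g]
  add_mem' ha hb A _ _ h hh g := by rw [map_add, map_add, ha A h hh g, hb A h hh g]
  algebraMap_mem' r A _ _ h hh g := by rw [AlgHom.commutes, AlgHom.commutes]

/-- `(g₁, …, gₙ, gₙ₊₁) ↦ (g₁, …, gₙ gₙ₊₁)`. -/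
def mulLast {M : Type*} [Mul M] {n : ℕ} (g : Fin (n + 2) → M) : Fin (n + 1) → M :=
  Fin.snoc (fun i : Fin n => g i.castSucc.castSucc)
    (g (Fin.last n).castSucc * g (Fin.last (n + 1)))

lemma map_mulLast {M N F : Type*} [Mul M] [Mul N] [FunLike F M N] [MulHomClass F M N] (φ : F)
    {n : ℕ} (g : Fin (n + 2) → M) (i : Fin (n + 1)) :
    φ (mulLast g i) = mulLast (fun j => φ (g j)) i := by
  induction i using Fin.lastCases <;> simp [mulLast]

/-- `f ↦ f^ζ`, where `f^ζ(g₁, …, gₙ) = f(g_{ζ(1)}, …, g_{ζ(m)})`. -/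
def reindexHom {m n : ℕ} (ζ : Fin m → Fin n) : Coord O H m →ₐ[O] Coord O H n :=
  evalAt fun j => coordPt (ζ j)

/-- `f ↦ f̂`, where `f̂(g₁, …, gₙ₊₁) = f(g₁, …, gₙ gₙ₊₁)`. -/
def hatHom (n : ℕ) : Coord O H (n + 1) →ₐ[O] Coord O H (n + 2) :=
  evalAt (mulLast coordPt)

lemma evalAt_reindexHom {m n : ℕ} (ζ : Fin m → Fin n) (f : Coord O H m) (g : Fin n → Pt O H A) :
    evalAt g (reindexHom ζ f) = evalAt (fun j => g (ζ j)) f := by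
  have h := congrArg (fun ψ => ψ f) (comp_evalAt (evalAt g) fun j => coordPt (ζ j))
  simp only [map_evalAt_coordPt] at h
  exact h

lemma evalAt_hatHom {n : ℕ} (f : Coord O H (n + 1)) (g : Fin (n + 2) → Pt O H A) :
    evalAt g (hatHom n f) = evalAt (mulLast g) f := by
  have h := congrArg (fun ψ => ψ f) (comp_evalAt (evalAt g) (mulLast coordPt))
  simp only [map_mulLast, map_evalAt_coordPt] at h
  exact h

lemma reindexHom_mem {m n : ℕ} (ζ : Fin m → Fin n) {f : Coord O H m}
    (hf : f ∈ invariants O H m) : reindexHom ζ f ∈ invariants O H n := by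
  intro A _ _ h hh g
  rw [evalAt_reindexHom, evalAt_reindexHom]
  exact hf A h hh _

lemma hatHom_mem {n : ℕ} {f : Coord O H (n + 1)}
    (hf : f ∈ invariants O H (n + 1)) : hatHom n f ∈ invariants O H (n + 2) := by
  intro A _ _ h hh g
  rw [evalAt_hatHom, evalAt_hatHom, ← hf A h hh (mulLast g)]
  congr 2
  funext i
  exact (map_mulLast (MulAut.conj h) g i).symm

/-- Pullback of functions along a morphism `G = Spec H → G' = Spec H'`. -/
def pullHom {H' : Type u} [CommRing H'] [HopfAlgebra O H'] (p : H' →ₐc[O] H) (n : ℕ) :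
    Coord O H' n →ₐ[O] Coord O H n :=
  evalAt fun i => Pt.push p (coordPt i)

lemma evalAt_pullHom {H' : Type u} [CommRing H'] [HopfAlgebra O H'] (p : H' →ₐc[O] H) {n : ℕ}
    (f : Coord O H' n) (g : Fin n → Pt O H A) :
    evalAt g (pullHom p n f) = evalAt (fun i => Pt.push p (g i)) f := by
  have h := congrArg (fun ψ => ψ f) (comp_evalAt (evalAt g) fun i => Pt.push p (coordPt i))
  have h' : ∀ i, Pt.map (evalAt g) (Pt.push p (coordPt i)) = Pt.push p (g i) := fun i => by
    conv_rhs => rw [← map_evalAt_coordPt g i]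
    rfl
  simp only [h'] at h
  exact h

lemma coord_ext {n : ℕ} {f f' : Coord O H n}
    (h : ∀ (A : Type u) [CommRing A] [Algebra O A] (g : Fin n → Pt O H A),
      evalAt g f = evalAt g f') : f = f' := by
  have h1 : evalAt (coordPt (O := O) (H := H) (n := n)) = AlgHom.id O _ := by
    apply PiTensorProduct.algHom_ext
    intro i
    rw [evalAt_single]
    rfl
  simpa [h1] using h _ coordPt

lemma push_mem_neutralPt {H' : Type u} [CommRing H'] [HopfAlgebra O H'] (p : H' →ₐc[O] H)
    {h : Pt O H A} (hh : h ∈ neutralPt A) : Pt.push p h ∈ neutralPt (H := H') A := by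
  intro t
  have key : ∀ x ∈ neutralLocus O H,
      PrimeSpectrum.comap (p : H' →ₐ[O] H).toRingHom x ∈ neutralLocus O H' := by
    intro x hx
    have e1 : ∀ y, PrimeSpectrum.comap (algebraMap O H')
        (PrimeSpectrum.comap (p : H' →ₐ[O] H).toRingHom y) =
          PrimeSpectrum.comap (algebraMap O H) y := by
      intro y
      rw [← PrimeSpectrum.comap_comp_apply]
      congr 2
      exact (p : H' →ₐ[O] H).comp_algebraMap
    have e2 : ∀ s, PrimeSpectrum.comap (p : H' →ₐ[O] H).toRingHom
        (PrimeSpectrum.comap (Bialgebra.counitAlgHom O H).toRingHom s) =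
          PrimeSpectrum.comap (Bialgebra.counitAlgHom O H').toRingHom s := by
      intro s
      rw [← PrimeSpectrum.comap_comp_apply]
      congr 2
      ext y
      simp
    have hne : PrimeSpectrum.comap (Bialgebra.counitAlgHom O H).toRingHom
        (PrimeSpectrum.comap (algebraMap O H) x) ∈ PrimeSpectrum.comap (algebraMap O H) ⁻¹'
          {PrimeSpectrum.comap (algebraMap O H) x} := by
      by_contra hn
      have hx' : x ∈ connectedComponentIn _ _ := hx
      rw [connectedComponentIn_eq_empty hn] at hx'
      exact hx'
    have h1 := (PrimeSpectrum.continuous_comap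
      (p : H' →ₐ[O] H).toRingHom).continuousOn.image_connectedComponentIn_subset hne
        ⟨x, hx, rfl⟩
    rw [e2] at h1
    change _ ∈ connectedComponentIn _ _
    rw [e1]
    refine connectedComponentIn_mono _ ?_ h1
    rintro _ ⟨y, hy, rfl⟩
    rw [Set.mem_preimage, e1]
    exact hy
  have := key _ (hh t)
  rwa [← PrimeSpectrum.comap_comp_apply] at this

lemma pullHom_mem {H' : Type u} [CommRing H'] [HopfAlgebra O H'] (p : H' →ₐc[O] H) {n : ℕ}
    {f : Coord O H' n} (hf : f ∈ invariants O H' n) : pullHom p n f ∈ invariants O H n := by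
  intro A _ _ h hh g
  rw [evalAt_pullHom, evalAt_pullHom, ← hf A _ (push_mem_neutralPt p hh) fun i => Pt.push p (g i)]
  simp only [map_mul, map_inv]

end Functions

/-! ### Pseudocharacters -/

section PseudoChar

variable (O H Γ : Type u) [CommRing O] [CommRing H] [HopfAlgebra O H] [Group Γ]

/-- An `A`-valued `G`-pseudocharacter of `Γ`: a sequence `(Θₙ)_{n ≥ 1}` of `𝒪`-algebra maps
`𝒪[Gⁿ]^{G⁰} → Map(Γⁿ, A)`. The map with index `n : ℕ` below is `Θₙ₊₁`. -/
@[ext]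
structure PseudoChar (A : Type u) [CommRing A] [Algebra O A] where
  Θ : ∀ n : ℕ, invariants O H (n + 1) →ₐ[O] ((Fin (n + 1) → Γ) → A)
  reindex : ∀ (m n : ℕ) (ζ : Fin (m + 1) → Fin (n + 1)) (f : invariants O H (m + 1))
    (γ : Fin (n + 1) → Γ),
    Θ n ⟨reindexHom ζ f, reindexHom_mem ζ f.2⟩ γ = Θ m f (fun j => γ (ζ j))
  hat : ∀ (n : ℕ) (f : invariants O H (n + 1)) (γ : Fin (n + 2) → Γ),
    Θ (n + 1) ⟨hatHom n f, hatHom_mem f.2⟩ γ = Θ n f (mulLast γ)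

variable {O H Γ} {A B : Type u} [CommRing A] [Algebra O A] [CommRing B] [Algebra O B]

/-- Specialisation of a pseudocharacter along `A → B`. -/
def PseudoChar.map (φ : A →ₐ[O] B) (T : PseudoChar O H Γ A) : PseudoChar O H Γ B where
  Θ n := AlgHom.pi fun γ => φ.comp ((Pi.evalAlgHom O (fun _ => A) γ).comp (T.Θ n))
  reindex m n ζ f γ := congrArg φ (T.reindex m n ζ f γ)
  hat n f γ := congrArg φ (T.hat n f γ)

/-- The pseudocharacter `Θ_ρ` of a representation `ρ : Γ → G(A)`:
`(Θ_ρ)ₙ(f)(γ₁, …, γₙ) = f(ρ(γ₁), …, ρ(γₙ))`. -/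
def PseudoChar.ofRep (ρ : Γ →* Pt O H A) : PseudoChar O H Γ A where
  Θ n := AlgHom.pi fun γ => (evalAt fun i => ρ (γ i)).comp (invariants O H (n + 1)).val
  reindex m n ζ f γ := evalAt_reindexHom ζ f.1 fun i => ρ (γ i)
  hat n f γ := by
    refine (evalAt_hatHom f.1 fun i => ρ (γ i)).trans ?_
    have h : mulLast (fun i => ρ (γ i)) = fun i => ρ (mulLast γ i) :=
      funext fun i => (map_mulLast ρ γ i).symm
    rw [h]
    rfl

/-- The image of a `G`-pseudocharacter under a morphism `G = Spec H → G' = Spec H'`. -/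
def PseudoChar.push {H' : Type u} [CommRing H'] [HopfAlgebra O H'] (p : H' →ₐc[O] H)
    (T : PseudoChar O H Γ A) : PseudoChar O H' Γ A where
  Θ n := (T.Θ n).comp (((pullHom p (n + 1)).comp (invariants O H' (n + 1)).val).codRestrict
    (invariants O H (n + 1)) fun f => pullHom_mem p f.2)
  reindex m n ζ f γ := by
    refine Eq.trans ?_ (T.reindex m n ζ ⟨pullHom p (m + 1) f, pullHom_mem p f.2⟩ γ)
    have : pullHom p (n + 1) (reindexHom ζ f.1) = reindexHom ζ (pullHom p (m + 1) f.1) :=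
      coord_ext fun A _ _ g => by simp only [evalAt_pullHom, evalAt_reindexHom]
    exact congrArg (fun x => T.Θ n x γ) (Subtype.ext this)
  hat n f γ := by
    refine Eq.trans ?_ (T.hat n ⟨pullHom p (n + 1) f, pullHom_mem p f.2⟩ γ)
    have : pullHom p (n + 2) (hatHom n f.1) = hatHom n (pullHom p (n + 1) f.1) :=
      coord_ext fun A _ _ g => by
        simp only [evalAt_pullHom, evalAt_hatHom]
        congr 2
        funext i
        exact (map_mulLast (Pt.push p) g i).symm
    exact congrArg (fun x => T.Θ (n + 1) x γ) (Subtype.ext this)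

end PseudoChar

/-! ### Constant group schemes -/

/-- `Map(Δ, 𝒪)`, the coordinate ring of the constant group scheme attached to `Δ`. -/
def ConstCoord (O Δ : Type*) : Type _ := Δ → O

namespace ConstCoord
variable (O Δ : Type*) [CommRing O]

instance : CommRing (ConstCoord O Δ) := inferInstanceAs (CommRing (Δ → O))
instance : Algebra O (ConstCoord O Δ) := inferInstanceAs (Algebra O (Δ → O))

variable {Δ}

/-- Evaluation `Map(Δ, 𝒪) → 𝒪` at `δ`. -/
def ev (δ : Δ) : ConstCoord O Δ →ₐ[O] O := Pi.evalAlgHom O (fun _ => O) δ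

/-- The algebra map to `Map(Δ, 𝒪)` with given components. -/
def lift {B : Type*} [CommRing B] [Algebra O B] (φ : Δ → (B →ₐ[O] O)) : B →ₐ[O] ConstCoord O Δ :=
  AlgHom.pi (A := fun _ : Δ => O) φ

lemma ev_lift {B : Type*} [CommRing B] [Algebra O B] (φ : Δ → (B →ₐ[O] O)) (δ : Δ) (x : B) :
    ev O δ (lift O φ x) = φ δ x := rfl

lemma ext {f g : ConstCoord O Δ} (h : ∀ δ, ev O δ f = ev O δ g) : f = g := funext h

variable [DecidableEq Δ]

/-- The indicator function of `{δ}`. -/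
def ind (δ : Δ) : ConstCoord O Δ := Pi.single (M := fun _ => O) δ 1

variable {O}
lemma ev_ind (a b : Δ) : ev O a (ind O b) = if a = b then 1 else 0 := Pi.single_apply b 1 a

lemma ind_mul_ind (a b : Δ) : ind O a * ind O b = if a = b then ind O a else 0 := by
  apply ext
  intro c
  rw [map_mul, ev_ind, ev_ind]
  split_ifs <;> simp_all [ev_ind]

/-- The antipode `f ↦ (a ↦ f(a⁻¹))`. -/
def antipodeHom [Group Δ] : ConstCoord O Δ →ₐ[O] ConstCoord O Δ := lift O fun a => ev O a⁻¹

lemma antipodeHom_ind [Group Δ] (x : Δ) : antipodeHom (ind O x) = ind O x⁻¹ := by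
  apply ext
  intro c
  simp [antipodeHom, ev_lift, ev_ind, inv_eq_iff_eq_inv]

variable [Fintype Δ]

lemma sum_ind : ∑ a : Δ, ind O a = 1 := by
  apply ext
  intro c
  simp [ev_ind]

lemma hom_ext {M : Type*} [AddCommMonoid M] [Module O M] {f g : ConstCoord O Δ →ₗ[O] M}
    (h : ∀ δ, f (ind O δ) = g (ind O δ)) : f = g :=
  (Pi.basisFun O Δ).ext (f₁ := f) (f₂ := g) fun δ => by
    rw [Pi.basisFun_apply]; exact h δ

lemma algHom_ext {M : Type*} [Semiring M] [Algebra O M] {f g : ConstCoord O Δ →ₐ[O] M}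
    (h : ∀ δ, f (ind O δ) = g (ind O δ)) : f = g :=
  AlgHom.toLinearMap_injective (hom_ext h)

variable (O Δ) [Group Δ]

/-- The comultiplication `f ↦ ((a, b) ↦ f(ab))`, with `Map(Δ, 𝒪) ⊗ Map(Δ, 𝒪) ≅ Map(Δ × Δ, 𝒪)`. -/
def comulHom : ConstCoord O Δ →ₐ[O] ConstCoord O Δ ⊗[O] ConstCoord O Δ :=
  (Algebra.TensorProduct.piScalarRight O O (ConstCoord O Δ) Δ).symm.toAlgHom.comp
    (AlgHom.pi fun b => lift O fun a => ev O (a * b))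

variable {O Δ}

lemma comulHom_ind (x : Δ) : comulHom O Δ (ind O x) = ∑ a, ind O a ⊗ₜ[O] ind O (a⁻¹ * x) := by
  apply (Algebra.TensorProduct.piScalarRight O O (ConstCoord O Δ) Δ).injective
  refine ((Algebra.TensorProduct.piScalarRight O O (ConstCoord O Δ) Δ).apply_symm_apply _).trans ?_
  refine Eq.trans ?_ (map_sum (Algebra.TensorProduct.piScalarRight O O (ConstCoord O Δ) Δ)
    (fun a => ind O a ⊗ₜ[O] ind O (a⁻¹ * x)) Finset.univ).symm
  funext b
  rw [Finset.sum_apply]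
  refine Eq.trans ?_ (Finset.sum_congr rfl fun a _ => (congrFun
    (Algebra.TensorProduct.piScalarRight_tmul (R := O) O (A := ConstCoord O Δ) (ι := Δ)
      (ind O a) (ind O (a⁻¹ * x) : Δ → O)) b).symm)
  apply ext
  intro c
  change ev O (c * b) (ind O x) = ev O c (∑ a, ev O b (ind O (a⁻¹ * x)) • ind O a)
  simp only [map_sum, map_smul, ev_ind, eq_inv_mul_iff_mul_eq, smul_eq_mul]
  simp

instance : Bialgebra O (ConstCoord O Δ) :=
  Bialgebra.ofAlgHom (comulHom O Δ) (ev O 1)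
    (algHom_ext fun x => by
      simp only [AlgHom.coe_comp, Function.comp_apply, comulHom_ind, map_sum,
        Algebra.TensorProduct.map_tmul, TensorProduct.sum_tmul, TensorProduct.tmul_sum,
        AlgHom.coe_id, id_eq]
      rw [Finset.sum_comm]
      refine Finset.sum_congr rfl fun c _ => ?_
      exact (Fintype.sum_equiv (Equiv.mulLeft c) _ _ fun d => by simp [mul_assoc]).symm)
    (algHom_ext fun x => by
      simp only [AlgHom.coe_comp, Function.comp_apply, comulHom_ind, map_sum,
        Algebra.TensorProduct.map_tmul, ev_ind, AlgHom.coe_id, id_eq]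
      rw [Finset.sum_eq_single 1] <;> simp +contextual [eq_comm])
    (algHom_ext fun x => by
      simp only [AlgHom.coe_comp, Function.comp_apply, comulHom_ind, map_sum,
        Algebra.TensorProduct.map_tmul, ev_ind, AlgHom.coe_id, id_eq]
      rw [Finset.sum_eq_single x] <;> simp +contextual [eq_inv_mul_iff_mul_eq])

instance : HopfAlgebra O (ConstCoord O Δ) :=
  HopfAlgebra.ofAlgHom antipodeHom
    (algHom_ext fun x => by
      change Algebra.TensorProduct.lift _ _ (fun _ _ => Commute.all _ _) (comulHom O Δ (ind O x)) =
        algebraMap O _ (ev O 1 (ind O x))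
      simp only [comulHom_ind, map_sum, Algebra.TensorProduct.lift_tmul, antipodeHom_ind,
        AlgHom.coe_id, id_eq, ind_mul_ind, ev_ind]
      by_cases h : 1 = x
      · subst h
        simpa using (Equiv.sum_comp (Equiv.inv Δ) fun a => ind O a).trans sum_ind
      · simp [h, Ne.symm h])
    (algHom_ext fun x => by
      change Algebra.TensorProduct.lift _ _ (fun _ _ => Commute.all _ _) (comulHom O Δ (ind O x)) =
        algebraMap O _ (ev O 1 (ind O x))
      simp only [comulHom_ind, map_sum, Algebra.TensorProduct.lift_tmul, antipodeHom_ind,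
        AlgHom.coe_id, id_eq, ind_mul_ind, ev_ind]
      by_cases h : 1 = x
      · subst h
        simp [sum_ind]
      · simp [h, Ne.symm h])

/-- The homomorphism from `Δ` to the `A`-points of the constant group scheme attached to `Δ`. -/
def point (A : Type*) [CommRing A] [Algebra O A] : Δ →* Pt O (ConstCoord O Δ) A where
  toFun δ := toConv ((Algebra.ofId O A).comp (ev O δ))
  map_one' := rfl
  map_mul' a b := by
    apply WithConv.ext
    refine algHom_ext fun x => ?_
    refine Eq.trans ?_ (AlgHom.convMul_apply _ _ _).symm
    change algebraMap O A (ev O (a * b) (ind O x)) =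
      Algebra.TensorProduct.lift _ _ (fun _ _ => Commute.all _ _) (comulHom O Δ (ind O x))
    simp only [comulHom_ind, map_sum, Algebra.TensorProduct.lift_tmul, AlgHom.coe_comp,
      Function.comp_apply, ev_ind, Algebra.ofId_apply]
    rw [Finset.sum_eq_single a] <;> simp +contextual [eq_inv_mul_iff_mul_eq, eq_comm]

end ConstCoord

/-! ### The moduli functors -/

section Moduli

variable {O H Γ : Type u} [CommRing O] [CommRing H] [HopfAlgebra O H] [Group Γ]

/-- `(R, ρ)` represents `Rep^Γ_G`, the functor sending an `𝒪`-algebra `A` to the set of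
representations `Γ → G(A)`. -/
def IsUniversalRep {R : Type u} [CommRing R] [Algebra O R] (ρ : Γ →* Pt O H R) : Prop :=
  ∀ (A : Type u) [CommRing A] [Algebra O A] (σ : Γ →* Pt O H A),
    ∃! φ : R →ₐ[O] A, (Pt.map φ).comp ρ = σ

/-- `(P, T)` represents `PC^Γ_G`, the functor sending an `𝒪`-algebra `A` to the set of `A`-valued
`G`-pseudocharacters of `Γ`. -/
def IsUniversalPseudoChar {P : Type u} [CommRing P] [Algebra O P] (T : PseudoChar O H Γ P) : Prop :=
  ∀ (A : Type u) [CommRing A] [Algebra O A] (S : PseudoChar O H Γ A),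
    ∃! φ : P →ₐ[O] A, T.map φ = S

/-- The ring `R^{G⁰}`, for `R` representing a functor of representations of `Γ` with universal
object `ρ`: the functions `r` on `Spec R` invariant under the action of `G⁰` by conjugation. The
morphisms `φ`, `φ'` below are the `A`-points of `Spec R`. -/
def repInvariants {R : Type u} [CommRing R] [Algebra O R] (ρ : Γ →* Pt O H R) :
    Subalgebra O R where
  carrier := {r | ∀ (A : Type u) [CommRing A] [Algebra O A] (h : Pt O H A), h ∈ neutralPt A →
    ∀ φ φ' : R →ₐ[O] A,
      (∀ γ, Pt.map φ' (ρ γ) = h * Pt.map φ (ρ γ) * h⁻¹) → φ' r = φ r}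
  mul_mem' ha hb A _ _ h hh φ φ' e := by
    rw [map_mul, map_mul, ha A h hh φ φ' e, hb A h hh φ φ' e]
  add_mem' ha hb A _ _ h hh φ φ' e := by
    rw [map_add, map_add, ha A h hh φ φ' e, hb A h hh φ φ' e]
  algebraMap_mem' r A _ _ h hh φ φ' e := by rw [AlgHom.commutes, AlgHom.commutes]

variable {Δ : Type u} [Group Δ] [Fintype Δ] [DecidableEq Δ] (p : ConstCoord O Δ →ₐc[O] H)
  (π : Γ →* Δ)

/-- `ρ : Γ → G(A)` is admissible: its composite with `Π : G → Δ` (given by `p`) is `π`. -/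
def IsAdmissibleRep {A : Type u} [CommRing A] [Algebra O A] (ρ : Γ →* Pt O H A) : Prop :=
  (Pt.push p).comp ρ = (ConstCoord.point A).comp π

/-- A `G`-pseudocharacter is admissible: its image under `Π : G → Δ` is the pseudocharacter
attached to `π`. -/
def IsAdmissiblePseudoChar {A : Type u} [CommRing A] [Algebra O A]
    (T : PseudoChar O H Γ A) : Prop :=
  T.push p = PseudoChar.ofRep ((ConstCoord.point A).comp π)

/-- `(R, ρ)` represents the functor `Rep^Γ_{G,π}` of admissible representations. -/
def IsUniversalAdmissibleRep {R : Type u} [CommRing R] [Algebra O R] (ρ : Γ →* Pt O H R) : Prop :=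
  IsAdmissibleRep p π ρ ∧
  ∀ (A : Type u) [CommRing A] [Algebra O A] (σ : Γ →* Pt O H A), IsAdmissibleRep p π σ →
    ∃! φ : R →ₐ[O] A, (Pt.map φ).comp ρ = σ

/-- `(P, T)` represents the functor `PC^Γ_{G,π}` of admissible pseudocharacters. -/
def IsUniversalAdmissiblePseudoChar {P : Type u} [CommRing P] [Algebra O P]
    (T : PseudoChar O H Γ P) : Prop :=
  IsAdmissiblePseudoChar p π T ∧
  ∀ (A : Type u) [CommRing A] [Algebra O A] (S : PseudoChar O H Γ A),
    IsAdmissiblePseudoChar p π S → ∃! φ : P →ₐ[O] A, T.map φ = S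

end Moduli

end

end GenTorus

open scoped TensorProduct
open WithConv

namespace GenTorus

noncomputable section

/-! A torus is linearly reductive over any base. When it is split, the coefficient of the trivial
character is a normalised two-sided invariant integral on its coordinate ring. Such an integral is
unique (`IsHaar.unique`), so it descends along the covering that splits the torus
(`IsHaar.descend`). Integrating over conjugates gives Reynolds operators from `𝒪[Gⁿ]` onto
`𝒪[Gⁿ]^{G⁰}` that are linear over the invariants and commute with `f ↦ f^ζ` and `f ↦ f̂`.

The ring `𝒪(Rep)` is the quotient of the coordinate ring of `G^Γ` by the relations of a
homomorphism, and each of its elements is a value `f(ρ(γ₁), …, ρ(γₙ))`. If such a value is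
`G⁰`-invariant, averaging `f` does not change it (`IsUniversalRepWith.evalAt_reynolds`). Hence
`𝒪(Rep)^{G⁰}` consists of values of invariant functions, and a morphism out of it is determined by
the pseudocharacter it induces.

Conversely, a pseudocharacter precomposed with the Reynolds operators is a family of linear
functionals on the rings `𝒪[Gⁿ]`. Condition (1) glues them to a functional on the coordinate ring of
`G^Γ`, and condition (2) makes it vanish on the relations (`RepRing.exists_functional`). The
functional on `𝒪(Rep)` is only linear, but on invariants it is computed by the algebra maps `Θₙ`,
hence multiplicative. So `𝒪(Rep)^{G⁰}` itself represents pseudocharacters, which yields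
representability and the comparison together.

Both parts of the theorem are instances of one statement with a set `W` of prescribed values at
invariant functions on `G`: empty for (a), the values of functions pulled back from `Δ` for (b). -/

/-! ### Normalised invariant integrals on Hopf algebras -/

section Integral

variable {O T D D' : Type*} [CommRing O] [CommRing T] [HopfAlgebra O T]
  [CommRing D'] [Algebra O D'] [CommRing D] [Algebra O D]

/-- `L : T → D` is a normalised two-sided invariant integral on `T`, with values in the
`O`-algebra `D`. -/
structure IsHaar (L : T →ₗ[O] D) : Prop where
  map_one : L 1 = 1
  left : ∀ x, L.rTensor T (Coalgebra.comul (R := O) x) = L x ⊗ₜ 1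
  right : ∀ x, L.rTensor T (TensorProduct.comm O T T (Coalgebra.comul (R := O) x)) = L x ⊗ₜ 1

lemma IsHaar.comp {L : T →ₗ[O] D} (hL : IsHaar L) (φ : D →ₐ[O] D') :
    IsHaar (φ.toLinearMap ∘ₗ L) where
  map_one := by simp [hL.map_one]
  left x := by simp [LinearMap.rTensor_comp, hL.left]
  right x := by
    rw [LinearMap.rTensor_comp, LinearMap.comp_apply, hL.right]
    simp

/-- Both integrals agree with `x ↦ ∑ L(x₁) M(x₂)`. -/
lemma IsHaar.unique {L M : T →ₗ[O] D} (hL : IsHaar L) (hM : IsHaar M) : L = M := by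
  ext x
  let μ (N : T →ₗ[O] D) : D ⊗[O] T →ₗ[O] D := LinearMap.mul' O D ∘ₗ N.lTensor D
  have h1 := congrArg (μ M) (hL.left x)
  have h2 := congrArg (μ L) (hM.right x)
  have h3 : ∀ y : T ⊗[O] T, μ M (L.rTensor T y) =
      μ L (M.rTensor T (TensorProduct.comm O T T y)) := by
    intro y
    induction y with
    | zero => simp
    | add a b ha hb => simp only [map_add, ha, hb]
    | tmul a b => simp [μ, mul_comm]
  rw [h3, h2] at h1
  simpa [μ, hL.map_one, hM.map_one] using h1.symm

/-- A family of integrals with values in finitely many algebras is an integral with values in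
their product. -/
lemma IsHaar.pi {k : ℕ} {D : Fin k → Type*} [∀ i, CommRing (D i)] [∀ i, Algebra O (D i)]
    {L : ∀ i, T →ₗ[O] D i} (hL : ∀ i, IsHaar (L i)) : IsHaar (LinearMap.pi L) := by
  have key : ∀ (z : T ⊗[O] T) i, TensorProduct.piLeft O T D ((LinearMap.pi L).rTensor T z) i =
      (L i).rTensor T z := by
    intro z i
    induction z with
    | zero => simp
    | add a b ha hb => rw [map_add, map_add, Pi.add_apply, ha, hb, map_add]
    | tmul a b => simp
  refine ⟨funext fun i => (hL i).map_one, fun x => ?_, fun x => ?_⟩ <;>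
    refine (TensorProduct.piLeft O T D).injective (funext fun i => ?_)
  · rw [key, (hL i).left]; simp
  · rw [key, (hL i).right]; simp

/-- Integrals descend along faithfully flat ring extensions. -/
lemma IsHaar.descend [Module.FaithfullyFlat O D] {L : T →ₗ[O] D} (hL : IsHaar L) :
    ∃ I : T →ₗ[O] O, IsHaar I := by
  -- The two pushforwards of `L` to `D ⊗ D` are both integrals, so they agree by uniqueness. Thus
  -- `L` takes values in the equaliser of `D ⇉ D ⊗ D`, which is `O` by faithfully flat descent.
  have heq := (hL.comp (Algebra.TensorProduct.includeLeft (S := O) (A := D) (B := D))).unique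
    (hL.comp (Algebra.TensorProduct.includeRight (A := D) (B := D)))
  have hr : ∀ x, L x ∈ LinearMap.range (Algebra.linearMap O D) := fun x =>
    (Algebra.IsEffective.of_faithfullyFlat O D (L x)).mp
      (sub_eq_zero.mpr (congrArg (fun f => f x) heq))
  have hinj : Function.Injective (Algebra.linearMap O D) := FaithfulSMul.algebraMap_injective O D
  let e := LinearEquiv.ofInjective _ hinj
  let I : T →ₗ[O] O := e.symm.toLinearMap ∘ₗ L.codRestrict _ hr
  have hI : ∀ x, algebraMap O D (I x) = L x := fun x =>
    congrArg Subtype.val (e.apply_symm_apply (L.codRestrict _ hr x))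
  -- Invariance of `I` is an identity in `T`, and may be checked in `D ⊗ T`, where it becomes
  -- invariance of `L`.
  have hT := Module.FaithfullyFlat.tensorProduct_mk_injective (A := O) (B := D) T
  have key : ∀ z : T ⊗[O] T, (1 : D) ⊗ₜ[O] TensorProduct.lid O T (I.rTensor T z) =
      L.rTensor T z := by
    intro z
    induction z with
    | zero => simp
    | add a b ha hb => simp only [map_add, TensorProduct.tmul_add, ha, hb]
    | tmul a b =>
      simp [← hI, Algebra.algebraMap_eq_smul_one, TensorProduct.smul_tmul]
  refine ⟨I, hinj ?_, fun x => ?_, fun x => ?_⟩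
  · exact (hI 1).trans (by simp [hL.map_one])
  · refine (TensorProduct.lid O T).injective (hT ?_)
    simp only [TensorProduct.mk_apply, key, hL.left, TensorProduct.lid_tmul,
      ← TensorProduct.smul_tmul, ← hI, Algebra.algebraMap_eq_smul_one]
  · refine (TensorProduct.lid O T).injective (hT ?_)
    simp only [TensorProduct.mk_apply, key, hL.right, TensorProduct.lid_tmul,
      ← TensorProduct.smul_tmul, ← hI, Algebra.algebraMap_eq_smul_one]

/-- The coefficient of the trivial character is an integral on a diagonalisable group. -/
lemma isHaar_coeff_zero (D : Type*) [CommRing D] (M : Type*) [AddCommGroup M] :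
    IsHaar (O := D) (T := AddMonoidAlgebra D M) (D := D)
      (Finsupp.lapply 0 ∘ₗ (AddMonoidAlgebra.coeffLinearEquiv D).toLinearMap) := by
  -- Characters are group-like, so invariance compares the character `m` with `1`: they coincide for
  -- `m = 0`, and otherwise the coefficient at `0` vanishes.
  have key : ∀ (m : M) (d : D), ((Finsupp.single m d : M →₀ D) 0) ⊗ₜ[D]
      (AddMonoidAlgebra.single m 1 : AddMonoidAlgebra D M) =
        ((Finsupp.single m d : M →₀ D) 0) ⊗ₜ[D] 1 := by
    intro m d
    by_cases h : m = 0
    · subst h; rfl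
    · simp [h]
  have key' : ∀ (m : M) (d : D), ((Finsupp.single m 1 : M →₀ D) 0) ⊗ₜ[D]
      (AddMonoidAlgebra.single m d : AddMonoidAlgebra D M) =
        ((Finsupp.single m d : M →₀ D) 0) ⊗ₜ[D] AddMonoidAlgebra.single m 1 := by
    intro m d
    have h1 : (AddMonoidAlgebra.single m d : AddMonoidAlgebra D M) =
      d • AddMonoidAlgebra.single m 1 := by simp
    have h2 : (Finsupp.single m d : M →₀ D) = d • Finsupp.single m 1 := by simp
    rw [h1, h2, TensorProduct.tmul_smul, Finsupp.smul_apply, TensorProduct.smul_tmul']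
  refine ⟨by simp, fun x => ?_, fun x => ?_⟩ <;>
    induction x using AddMonoidAlgebra.induction_linear with
    | zero => simp
    | add a b ha hb => simp only [map_add, ha, hb, TensorProduct.add_tmul]
    | single m d => simp [← key m d, key' m d]

lemma IsHaar.of_equiv {T' : Type*} [CommRing T'] [HopfAlgebra O T'] (e : T ≃ₐc[O] T')
    {L : T' →ₗ[O] D} (hL : IsHaar L) :
    IsHaar (L ∘ₗ (e : T →ₗ[O] T')) := by
  have hinj : Function.Injective ((e : T →ₗ[O] T').lTensor D) :=
    (LinearEquiv.lTensor D (e : T ≃ₗ[O] T')).injective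
  have hc : ∀ x, TensorProduct.map (e : T →ₗ[O] T') (e : T →ₗ[O] T') (Coalgebra.comul x) =
      Coalgebra.comul (R := O) (e x) := fun x => CoalgHomClass.map_comp_comul_apply e x
  have key : ∀ z : T ⊗[O] T, (e : T →ₗ[O] T').lTensor D ((L ∘ₗ (e : T →ₗ[O] T')).rTensor T z) =
      L.rTensor T' (TensorProduct.map (e : T →ₗ[O] T') (e : T →ₗ[O] T') z) := by
    intro z
    induction z with
    | zero => simp
    | add a b ha hb => simp only [map_add, ha, hb]
    | tmul a b => simp
  refine ⟨by simp [hL.map_one], fun x => hinj ?_, fun x => hinj ?_⟩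
  · rw [key, hc, hL.left]; simp
  · rw [key, TensorProduct.map_comm, hc, hL.right]; simp

lemma IsHaar.of_baseChange {L : D ⊗[O] T →ₗ[D] D} (hL : IsHaar L) :
    IsHaar (L.restrictScalars O ∘ₗ
      (Algebra.TensorProduct.includeRight (R := O) (A := D) (B := T)).toLinearMap) := by
  set L₀ := L.restrictScalars O ∘ₗ
    (Algebra.TensorProduct.includeRight (R := O) (A := D) (B := T)).toLinearMap with hL₀
  -- `J` is the canonical map from `T ⊗ T` to its base change; it intertwines the two
  -- comultiplications and the two swaps, which carries invariance from `L` to `L₀`.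
  let J (z : T ⊗[O] T) : (D ⊗[O] T) ⊗[D] (D ⊗[O] T) :=
    TensorProduct.AlgebraTensorModule.tensorTensorTensorComm O D O D D D T T
      (((1 : D) ⊗ₜ[D] (1 : D)) ⊗ₜ[O] z)
  have hJ : ∀ x : T, J (Coalgebra.comul x) = Coalgebra.comul (R := D) ((1 : D) ⊗ₜ[O] x) := by
    intro x
    simp [J]
  have hadd : ∀ a b, J (a + b) = J a + J b := fun a b => by
    simp [J, TensorProduct.tmul_add]
  have hzero : J 0 = 0 := by simp [J]
  have key : ∀ z : T ⊗[O] T, TensorProduct.lid D (D ⊗[O] T) (L.rTensor (D ⊗[O] T) (J z)) =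
      L₀.rTensor T z := by
    intro z
    induction z with
    | zero => simp [hzero]
    | add a b ha hb => simp only [map_add, ha, hb, hadd]
    | tmul a b => simp [J, hL₀, TensorProduct.smul_tmul']
  have hcomm : ∀ z : T ⊗[O] T, J (TensorProduct.comm O T T z) = TensorProduct.comm D _ _ (J z) := by
    intro z
    induction z with
    | zero => simp [hzero]
    | add a b ha hb => simp only [map_add, ha, hb, hadd]
    | tmul a b => simp [J]
  refine ⟨hL.map_one, fun x => ?_, fun x => ?_⟩
  · rw [← key, hJ, hL.left]
    simp [hL₀, Algebra.TensorProduct.one_def, TensorProduct.smul_tmul']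
  · rw [← key, hcomm, hJ, hL.right]
    simp [hL₀, Algebra.TensorProduct.one_def, TensorProduct.smul_tmul']

end Integral

/-- A torus carries a normalised invariant integral. -/
theorem IsTorus.exists_isHaar {O T : Type u} [CommRing O] [CommRing T] [HopfAlgebra O T]
    (hT : IsTorus O T) : ∃ I : T →ₗ[O] O, IsHaar I := by
  obtain ⟨k, O', _, _, n, hflat, hsurj, he⟩ := hT
  choose L hL using fun i : Fin k => show ∃ L : T →ₗ[O] O' i, IsHaar L from
    ⟨_, ((isHaar_coeff_zero (O' i) (Fin (n i) → ℤ)).of_equiv (he i).some).of_baseChange⟩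
  -- The finite covering is replaced by the single faithfully flat algebra `∏ O'ᵢ`.
  have : Module.Flat O (∀ i, O' i) :=
    Module.Flat.of_linearEquiv (DFinsupp.linearEquivFunOnFintype (R := O) (M := O')).symm
  have : Module.FaithfullyFlat O (∀ i, O' i) := by
    refine Module.FaithfullyFlat.of_comap_surjective fun s => ?_
    obtain ⟨i, t, rfl⟩ := hsurj s
    refine ⟨PrimeSpectrum.comap (Pi.evalRingHom O' i) t, ?_⟩
    rw [← PrimeSpectrum.comap_comp_apply]
    rfl
  exact (IsHaar.pi hL).descend

/-! ### The Reynolds operator -/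

section Reynolds

variable {O H T A B : Type u} [CommRing O] [CommRing H] [HopfAlgebra O H] [CommRing T]
  [HopfAlgebra O T] [CommRing A] [Algebra O A] [CommRing B] [Algebra O B]

lemma Pt.map_comp_apply {C : Type*} [CommRing C] [Algebra O C] (ψ : B →ₐ[O] C) (φ : A →ₐ[O] B)
    (g : Pt O H A) : Pt.map ψ (Pt.map φ g) = Pt.map (ψ.comp φ) g := rfl

lemma evalAt_coordPt (n : ℕ) : evalAt (coordPt (O := O) (H := H) (n := n)) = AlgHom.id O _ := by
  apply PiTensorProduct.algHom_ext
  intro i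
  rw [evalAt_single]
  rfl

lemma evalAt_coordPt_apply {n : ℕ} (g : Fin n → Pt O H A)
    (i : Fin n) (h : H) : evalAt g ((coordPt (O := O) (H := H) i).ofConv h) = (g i).ofConv h :=
  congrArg (fun x => x.ofConv h) (map_evalAt_coordPt g i)

lemma apply_evalAt (φ : A →ₐ[O] B) {n : ℕ} (g : Fin n → Pt O H A) (f : Coord O H n) :
    φ (evalAt g f) = evalAt (fun i => Pt.map φ (g i)) f :=
  congrArg (fun ψ => ψ f) (comp_evalAt φ g)

/-- Integration along `T`: the map `A ⊗ T → A` induced by `I : T → O`. -/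
def integrate (I : T →ₗ[O] O) (A : Type u) [CommRing A] [Algebra O A] : A ⊗[O] T →ₗ[O] A :=
  (TensorProduct.rid O A).toLinearMap ∘ₗ I.lTensor A

@[simp]
lemma integrate_tmul (I : T →ₗ[O] O) (a : A) (t : T) : integrate I A (a ⊗ₜ t) = I t • a := by
  simp [integrate]

lemma integrate_mul_tmul_one (I : T →ₗ[O] O) (z : A ⊗[O] T) (a : A) :
    integrate I A (z * a ⊗ₜ 1) = integrate I A z * a := by
  induction z with
  | zero => simp
  | add x y hx hy => rw [add_mul, map_add, hx, hy, map_add, add_mul]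
  | tmul b t => simp

lemma apply_integrate (I : T →ₗ[O] O) (φ : A →ₐ[O] B) (z : A ⊗[O] T) :
    φ (integrate I A z) = integrate I B (Algebra.TensorProduct.map φ (AlgHom.id O T) z) := by
  induction z with
  | zero => simp
  | add x y hx hy => simp only [map_add, hx, hy]
  | tmul b t => simp

/-- The universal point of `Spec T`, regarded as a point of `Spec H` with values in `A ⊗ T`. -/
def torusPt (q : H →ₐc[O] T) (A : Type u) [CommRing A] [Algebra O A] : Pt O H (A ⊗[O] T) :=
  Pt.push q (toConv Algebra.TensorProduct.includeRight)

/-- The conjugate of a point of `G` by the universal point of `Spec T`. -/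
def torusConj (q : H →ₐc[O] T) (g : Pt O H A) : Pt O H (A ⊗[O] T) :=
  torusPt q A * Pt.map Algebra.TensorProduct.includeLeft g * (torusPt q A)⁻¹

lemma map_torusPt (q : H →ₐc[O] T) (φ : A →ₐ[O] B) :
    Pt.map (Algebra.TensorProduct.map φ (AlgHom.id O T)) (torusPt q A) = torusPt q B := by
  refine WithConv.ext (AlgHom.ext fun x => ?_)
  change Algebra.TensorProduct.map φ (AlgHom.id O T) (1 ⊗ₜ q x) = 1 ⊗ₜ q x
  simp

lemma map_torusConj (q : H →ₐc[O] T) (φ : A →ₐ[O] B) (g : Pt O H A) :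
    Pt.map (Algebra.TensorProduct.map φ (AlgHom.id O T)) (torusConj q g) =
      torusConj q (Pt.map φ g) := by
  rw [torusConj, torusConj, map_mul, map_mul, map_inv, map_torusPt, Pt.map_comp_apply,
    Pt.map_comp_apply]
  congr 4

lemma torusConj_mul (q : H →ₐc[O] T) (g g' : Pt O H A) :
    torusConj q (g * g') = torusConj q g * torusConj q g' := by
  simp [torusConj, mul_assoc]

/-- The average of a function over the conjugates of a tuple of points. -/
def avg (q : H →ₐc[O] T) (I : T →ₗ[O] O) {n : ℕ} (g : Fin n → Pt O H A) : Coord O H n →ₗ[O] A :=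
  integrate I A ∘ₗ (evalAt fun i => torusConj q (g i)).toLinearMap

lemma avg_apply (q : H →ₐc[O] T) (I : T →ₗ[O] O) {n : ℕ} (g : Fin n → Pt O H A)
    (f : Coord O H n) :
    avg q I g f = integrate I A (evalAt (fun i => torusConj q (g i)) f) := rfl

lemma apply_avg (q : H →ₐc[O] T) (I : T →ₗ[O] O) (φ : A →ₐ[O] B) {n : ℕ}
    (g : Fin n → Pt O H A) (f : Coord O H n) :
    φ (avg q I g f) = avg q I (fun i => Pt.map φ (g i)) f := by
  simp only [avg_apply, apply_integrate, apply_evalAt, map_torusConj]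

/-- The Reynolds operator on functions on `Gⁿ`. -/
def reynolds (q : H →ₐc[O] T) (I : T →ₗ[O] O) (n : ℕ) : Coord O H n →ₗ[O] Coord O H n :=
  avg q I coordPt

variable {q : H →ₐc[O] T} {I : T →ₗ[O] O}

lemma evalAt_reynolds {n : ℕ} (g : Fin n → Pt O H A) (f : Coord O H n) :
    evalAt g (reynolds q I n f) = avg q I g f := by
  simp only [reynolds, apply_avg, map_evalAt_coordPt]

/-- Simultaneous conjugation acts on each coordinate separately. -/
lemma reynolds_reindexHom {m n : ℕ} (ζ : Fin m → Fin n) (f : Coord O H m) :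
    reynolds q I n (reindexHom ζ f) = reindexHom ζ (reynolds q I m f) :=
  coord_ext fun A _ _ g => by
    rw [evalAt_reynolds, evalAt_reindexHom, evalAt_reynolds, avg_apply, avg_apply,
      evalAt_reindexHom]

/-- Conjugation is multiplicative, so it commutes with multiplying the last two entries. -/
lemma reynolds_hatHom {n : ℕ} (f : Coord O H (n + 1)) :
    reynolds q I (n + 2) (hatHom n f) = hatHom n (reynolds q I (n + 1) f) :=
  coord_ext fun A _ _ g => by
    rw [evalAt_reynolds, evalAt_hatHom, evalAt_reynolds, avg_apply, avg_apply, evalAt_hatHom]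
    congr 3
    funext i
    let c : Pt O H A →ₙ* Pt O H (A ⊗[O] T) := ⟨torusConj q, torusConj_mul q⟩
    exact (map_mulLast c g i).symm

/-- The image of `Spec T → G` on points is the neutral component `G⁰`. -/
def IsOntoNeutral (q : H →ₐc[O] T) : Prop :=
  ∀ (A : Type u) [CommRing A] [Algebra O A],
    Set.range (Pt.push q : Pt O T A →* Pt O H A) = neutralPt A

lemma torusPt_mem (hq : IsOntoNeutral q) (A : Type u) [CommRing A] [Algebra O A] :
    torusPt q A ∈ neutralPt (A ⊗[O] T) :=
  hq (A ⊗[O] T) ▸ ⟨_, rfl⟩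

/-- Invariance is tested at the universal point of the torus: the function is constant along the
orbit. -/
lemma evalAt_torusConj_of_mem (hq : IsOntoNeutral q) {n : ℕ} {f : Coord O H n}
    (hf : f ∈ invariants O H n)
    (g : Fin n → Pt O H A) : evalAt (fun i => torusConj q (g i)) f = evalAt g f ⊗ₜ 1 :=
  (hf _ _ (torusPt_mem hq A) _).trans
    (apply_evalAt (Algebra.TensorProduct.includeLeft (S := O) (A := A) (B := T)) g f).symm

/-- The invariant factor is constant along the orbit and comes out of the integral. -/
lemma reynolds_mul_of_mem (hq : IsOntoNeutral q) {n : ℕ} (f : Coord O H n) {w : Coord O H n}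
    (hw : w ∈ invariants O H n) : reynolds q I n (f * w) = reynolds q I n f * w :=
  coord_ext fun A _ _ g => by
    rw [map_mul (evalAt g), evalAt_reynolds, evalAt_reynolds, avg_apply, avg_apply, map_mul,
      evalAt_torusConj_of_mem hq hw, integrate_mul_tmul_one]

lemma reynolds_of_mem (hq : IsOntoNeutral q) (hI : IsHaar I) {n : ℕ} {f : Coord O H n}
    (hf : f ∈ invariants O H n) : reynolds q I n f = f :=
  coord_ext fun A _ _ g => by
    rw [evalAt_reynolds, avg_apply, evalAt_torusConj_of_mem hq hf, integrate_tmul, hI.map_one,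
      one_smul]

variable (A) in
/-- Translation of `A ⊗ T` by a point `t` of `Spec T`. -/
def translate (t : Pt O T A) : A ⊗[O] T →ₐ[O] A ⊗[O] T :=
  Algebra.TensorProduct.lift (Algebra.TensorProduct.includeLeft (S := O))
    (toConv (Algebra.TensorProduct.includeRight (R := O) (A := A) (B := T)) *
      Pt.map Algebra.TensorProduct.includeLeft t).ofConv (fun _ _ => Commute.all _ _)

/-- Translation sends `s` to `∑ t(s₂) ⊗ s₁`, whose integral `∑ I(s₁) t(s₂)` is `I(s)` by left
invariance. -/
lemma integrate_translate (hI : IsHaar I) (t : Pt O T A) (z : A ⊗[O] T) :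
    integrate I A (translate A t z) = integrate I A z := by
  induction z with
  | zero => simp
  | add x y hx hy => simp only [map_add, hx, hy]
  | tmul a s =>
    have key : ∀ z : T ⊗[O] T, integrate I A (a ⊗ₜ[O] (1 : T) *
        Algebra.TensorProduct.lift (Algebra.TensorProduct.includeRight (R := O) (A := A) (B := T))
          (Pt.map Algebra.TensorProduct.includeLeft t : Pt O T (A ⊗[O] T)).ofConv
          (fun _ _ => Commute.all _ _) z) =
        a * t.ofConv (TensorProduct.lid O T (I.rTensor T z)) := by
      intro z
      induction z with
      | zero => simp
      | add x y hx hy => simp only [map_add, mul_add, hx, hy]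
      | tmul x y =>
        rw [Algebra.TensorProduct.lift_tmul]
        change integrate I A (a ⊗ₜ[O] (1 : T) * ((1 : A) ⊗ₜ[O] x * t.ofConv y ⊗ₜ[O] (1 : T))) = _
        simp
    refine (congrArg (integrate I A) (Algebra.TensorProduct.lift_tmul _ _
      (fun _ _ => Commute.all _ _) a s)).trans ?_
    refine (congrArg (fun w => integrate I A (a ⊗ₜ[O] (1 : T) * w))
      (AlgHom.convMul_apply _ _ s)).trans ((key _).trans ?_)
    rw [hI.left]
    simp

/-- Substituting `z ↦ zt` in `z g z⁻¹` gives the conjugate by `z` of `t g t⁻¹`. -/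
lemma map_translate_torusConj (t : Pt O T A) (g : Pt O H A) :
    Pt.map (translate A t) (torusConj q g) =
      torusConj q (Pt.push q t * g * (Pt.push q t)⁻¹) := by
  have h1 : Pt.map (translate A t) (torusPt q A) =
      torusPt q A *
        Pt.map (Algebra.TensorProduct.includeLeft : A →ₐ[O] A ⊗[O] T) (Pt.push q t) := by
    have h : Pt.map (translate A t)
        (toConv (Algebra.TensorProduct.includeRight (R := O) (A := A) (B := T))) =
        toConv Algebra.TensorProduct.includeRight *
          Pt.map (Algebra.TensorProduct.includeLeft : A →ₐ[O] A ⊗[O] T) t := by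
      refine WithConv.ext (AlgHom.ext fun x => ?_)
      refine (Algebra.TensorProduct.lift_tmul _ _
        (fun _ _ => Commute.all _ _) (1 : A) x).trans ?_
      rw [map_one, one_mul]
    exact (congrArg (Pt.push q) h).trans (map_mul _ _ _)
  have h2 : Pt.map (translate A t) (Pt.map Algebra.TensorProduct.includeLeft g) =
      Pt.map (Algebra.TensorProduct.includeLeft : A →ₐ[O] A ⊗[O] T) g := by
    rw [Pt.map_comp_apply, translate, Algebra.TensorProduct.lift_comp_includeLeft]
  rw [torusConj, torusConj, map_mul, map_mul, map_inv, h1, h2, map_mul, map_mul, map_inv]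
  group

/-- By `IsOntoNeutral`, a point of `G⁰` comes from a point of the torus. Conjugating by it is a
translation of the variable of integration, which does not affect the integral. -/
lemma reynolds_mem (hq : IsOntoNeutral q) (hI : IsHaar I) {n : ℕ} (f : Coord O H n) :
    reynolds q I n f ∈ invariants O H n := by
  intro A _ _ h hh g
  rw [← hq] at hh
  obtain ⟨t, rfl⟩ := hh
  rw [evalAt_reynolds, evalAt_reynolds, avg_apply, avg_apply]
  conv_rhs => rw [← integrate_translate hI t, apply_evalAt]
  simp only [map_translate_torusConj]

end Reynolds

/-! ### The universal family of points of `G` indexed by a set -/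

section Family

variable (O H Γ : Type u) [CommRing O] [CommRing H] [HopfAlgebra O H]

/-- The relations that make `h ↦ X (γ, h)` an algebra homomorphism for every `γ`. -/
def familyIdeal : Ideal (MvPolynomial (Γ × H) O) :=
  Ideal.span {x | (∃ γ h h', x = MvPolynomial.X (γ, h + h') -
      (MvPolynomial.X (γ, h) + MvPolynomial.X (γ, h'))) ∨
    (∃ γ h h', x = MvPolynomial.X (γ, h * h') -
      MvPolynomial.X (γ, h) * MvPolynomial.X (γ, h')) ∨
    (∃ γ c, x = MvPolynomial.X (γ, algebraMap O H c) - MvPolynomial.C c)}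

/-- The coordinate ring of the product of copies of `G` indexed by `Γ`. -/
def FamilyRing : Type u := MvPolynomial (Γ × H) O ⧸ familyIdeal O H Γ

instance : CommRing (FamilyRing O H Γ) :=
  inferInstanceAs (CommRing (MvPolynomial (Γ × H) O ⧸ familyIdeal O H Γ))

instance : Algebra O (FamilyRing O H Γ) :=
  inferInstanceAs (Algebra O (MvPolynomial (Γ × H) O ⧸ familyIdeal O H Γ))

/-- The projection from the polynomial ring. -/
def FamilyRing.mk : MvPolynomial (Γ × H) O →ₐ[O] FamilyRing O H Γ :=
  Ideal.Quotient.mkₐ O (familyIdeal O H Γ)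

lemma FamilyRing.mk_surjective : Function.Surjective (FamilyRing.mk O H Γ) :=
  Ideal.Quotient.mk_surjective

variable {O H Γ}

lemma FamilyRing.mk_eq {x y : MvPolynomial (Γ × H) O} (h : x - y ∈ familyIdeal O H Γ) :
    FamilyRing.mk O H Γ x = FamilyRing.mk O H Γ y :=
  Ideal.Quotient.eq.mpr h

lemma FamilyRing.mk_X_algebraMap (γ : Γ) (c : O) :
    FamilyRing.mk O H Γ (MvPolynomial.X (γ, algebraMap O H c)) = algebraMap O _ c :=
  (FamilyRing.mk_eq (Ideal.subset_span (Or.inr (Or.inr ⟨γ, c, rfl⟩)))).trans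
    (AlgHom.commutes _ c)

lemma FamilyRing.mk_X_mul (γ : Γ) (h h' : H) :
    FamilyRing.mk O H Γ (MvPolynomial.X (γ, h * h')) =
      FamilyRing.mk O H Γ (MvPolynomial.X (γ, h)) * FamilyRing.mk O H Γ (MvPolynomial.X (γ, h')) :=
  (FamilyRing.mk_eq (Ideal.subset_span (Or.inr (Or.inl ⟨γ, h, h', rfl⟩)))).trans (map_mul _ _ _)

lemma FamilyRing.mk_X_add (γ : Γ) (h h' : H) :
    FamilyRing.mk O H Γ (MvPolynomial.X (γ, h + h')) =
      FamilyRing.mk O H Γ (MvPolynomial.X (γ, h)) + FamilyRing.mk O H Γ (MvPolynomial.X (γ, h')) :=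
  (FamilyRing.mk_eq (Ideal.subset_span (Or.inl ⟨γ, h, h', rfl⟩))).trans (map_add _ _ _)

/-- The universal family of points of `G`. -/
def familyPt (γ : Γ) : Pt O H (FamilyRing O H Γ) :=
  toConv
    { toFun h := FamilyRing.mk O H Γ (MvPolynomial.X (γ, h))
      map_one' := by simpa using FamilyRing.mk_X_algebraMap (O := O) (H := H) γ 1
      map_mul' := FamilyRing.mk_X_mul γ
      map_zero' := by simpa using FamilyRing.mk_X_algebraMap (O := O) (H := H) γ 0
      map_add' := FamilyRing.mk_X_add γ
      commutes' := FamilyRing.mk_X_algebraMap γ }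

lemma familyPt_apply (γ : Γ) (h : H) : (familyPt γ : Pt O H (FamilyRing O H Γ)).ofConv h =
    FamilyRing.mk O H Γ (MvPolynomial.X (γ, h)) := rfl

variable {A : Type u} [CommRing A] [Algebra O A]

/-- The morphism out of `FamilyRing` classifying a family of points. -/
def familyLift (g : Γ → Pt O H A) : FamilyRing O H Γ →ₐ[O] A :=
  Ideal.Quotient.liftₐ (familyIdeal O H Γ)
    (MvPolynomial.aeval fun x : Γ × H => (g x.1).ofConv x.2) (by
      intro x hx
      have : familyIdeal O H Γ ≤ RingHom.ker
          (MvPolynomial.aeval (R := O) fun x : Γ × H => (g x.1).ofConv x.2) := by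
        refine Ideal.span_le.mpr ?_
        rintro _ (⟨γ, h, h', rfl⟩ | ⟨γ, h, h', rfl⟩ | ⟨γ, c, rfl⟩) <;>
          simp [RingHom.mem_ker]
      exact this hx)

lemma map_familyLift (g : Γ → Pt O H A) (γ : Γ) :
    Pt.map (familyLift g) (familyPt γ) = g γ := by
  refine WithConv.ext (AlgHom.ext fun h => ?_)
  exact MvPolynomial.aeval_X _ (γ, h)

lemma family_hom_ext {φ ψ : FamilyRing O H Γ →ₐ[O] A}
    (h : ∀ γ, Pt.map φ (familyPt γ) = Pt.map ψ (familyPt γ)) : φ = ψ := by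
  refine Ideal.Quotient.algHom_ext _ (MvPolynomial.algHom_ext fun x => ?_)
  exact congrArg (fun g => g.ofConv x.2) (h x.1)

/-! ### Values of functions at tuples from a family of points -/

lemma evalAt_comp_append_left (g : Γ → Pt O H A) {m n : ℕ} (γ : Fin m → Γ) (δ : Fin n → Γ)
    (f : Coord O H m) :
    evalAt (fun i => g (Fin.append γ δ i)) (reindexHom (Fin.castAdd n) f) =
      evalAt (fun i => g (γ i)) f := by
  simp [evalAt_reindexHom]

lemma evalAt_comp_append_right (g : Γ → Pt O H A) {m n : ℕ} (γ : Fin m → Γ) (δ : Fin n → Γ)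
    (f : Coord O H n) :
    evalAt (fun i => g (Fin.append γ δ i)) (reindexHom (Fin.natAdd m) f) =
      evalAt (fun i => g (δ i)) f := by
  simp [evalAt_reindexHom]

/-- Two values of functions at tuples from a family are values at a common tuple. -/
lemma exists_common_tuple (g : Γ → Pt O H A) {a b : A}
    (ha : ∃ (n : ℕ) (γ : Fin (n + 1) → Γ) (f : Coord O H (n + 1)),
      evalAt (fun i => g (γ i)) f = a)
    (hb : ∃ (n : ℕ) (γ : Fin (n + 1) → Γ) (f : Coord O H (n + 1)),
      evalAt (fun i => g (γ i)) f = b) :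
    ∃ (n : ℕ) (γ : Fin (n + 1) → Γ) (f f' : Coord O H (n + 1)),
      evalAt (fun i => g (γ i)) f = a ∧ evalAt (fun i => g (γ i)) f' = b := by
  obtain ⟨m, γ, f, rfl⟩ := ha
  obtain ⟨n, δ, f', rfl⟩ := hb
  -- The concatenated tuple has length `(m + 1) + (n + 1)`, which is index `m + 1 + n` in the
  -- convention of tuples of length `n + 1`.
  exact ⟨m + 1 + n, Fin.append (m := m + 1) (n := n + 1) γ δ, reindexHom (Fin.castAdd (n + 1)) f,
    reindexHom (Fin.natAdd (m + 1)) f', evalAt_comp_append_left g γ δ f,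
    evalAt_comp_append_right g γ δ f'⟩

/-- A polynomial involves finitely many variables, so a function on `G^Γ` depends on finitely many
coordinates. Nonemptiness of `Γ` supplies a tuple of positive length even for constants. -/
lemma FamilyRing.exists_evalAt [Nonempty Γ] (b : FamilyRing O H Γ) :
    ∃ (n : ℕ) (γ : Fin (n + 1) → Γ) (f : Coord O H (n + 1)),
      evalAt (fun i => familyPt (γ i)) f = b := by
  obtain ⟨x, rfl⟩ := FamilyRing.mk_surjective O H Γ b
  induction x using MvPolynomial.induction_on with
  | C c =>
    exact ⟨0, fun _ => Classical.arbitrary Γ, algebraMap O _ c, AlgHom.commutes _ c⟩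
  | add x y hx hy =>
    obtain ⟨n, γ, f, f', h, h'⟩ := exists_common_tuple familyPt hx hy
    exact ⟨n, γ, f + f', by rw [map_add, map_add, h, h']⟩
  | mul_X x y hx =>
    obtain ⟨n, γ, f, f', h, h'⟩ := exists_common_tuple familyPt hx
      ⟨0, fun _ => y.1, (coordPt 0 : Pt O H (Coord O H 1)).ofConv y.2,
        evalAt_coordPt_apply (fun _ => familyPt y.1) 0 y.2⟩
    exact ⟨n, γ, f * f', by rw [map_mul, map_mul, h, h', ← familyPt_apply]⟩

/-- At a tuple of distinct elements of the universal family, a function is determined by its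
value. -/
lemma evalAt_familyPt_injective {n : ℕ} {γ : Fin n → Γ} (hγ : Function.Injective γ) :
    Function.Injective (evalAt (O := O) (H := H) fun i => familyPt (γ i)) := by
  classical
  -- The coordinate points of `Gⁿ`, placed at the positions `γ i` and extended by `1`; distinctness
  -- of the `γ i` makes this consistent. The morphism classifying `g` is a left inverse of
  -- evaluation.
  let g : Γ → Pt O H (Coord O H n) := fun δ => if h : ∃ i, γ i = δ then coordPt h.choose else 1
  have hg : ∀ i, g (γ i) = coordPt i := by
    intro i
    have h : ∃ j, γ j = γ i := ⟨i, rfl⟩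
    simp only [g, dif_pos h]
    exact congrArg _ (hγ h.choose_spec)
  refine Function.LeftInverse.injective (g := familyLift g) fun f => ?_
  rw [apply_evalAt]
  simp only [map_familyLift, hg, evalAt_coordPt]
  rfl

/-- Two finite tuples factor through a common tuple of distinct elements. -/
lemma exists_injective_tuple {m n : ℕ} (γ : Fin (m + 1) → Γ) (δ : Fin (n + 1) → Γ) :
    ∃ (k : ℕ) (ε : Fin (k + 1) → Γ) (ζ : Fin (m + 1) → Fin (k + 1))
      (ξ : Fin (n + 1) → Fin (k + 1)), Function.Injective ε ∧
        (∀ i, ε (ζ i) = γ i) ∧ ∀ i, ε (ξ i) = δ i := by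
  classical
  let s : Finset Γ := Finset.univ.image γ ∪ Finset.univ.image δ
  have hγ : ∀ i, γ i ∈ s := fun i =>
    Finset.mem_union_left _ (Finset.mem_image_of_mem _ (Finset.mem_univ i))
  have hδ : ∀ i, δ i ∈ s := fun i =>
    Finset.mem_union_right _ (Finset.mem_image_of_mem _ (Finset.mem_univ i))
  obtain ⟨k, hk⟩ := Nat.exists_eq_succ_of_ne_zero (Finset.card_ne_zero_of_mem (hγ 0))
  let e := s.equivFinOfCardEq hk
  exact ⟨k, fun i => (e.symm i).1, fun i => e ⟨γ i, hγ i⟩, fun i => e ⟨δ i, hδ i⟩,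
    Subtype.val_injective.comp e.symm.injective, fun i => by simp, fun i => by simp⟩

/-- A linear functional on `FamilyRing` is given by a compatible family of functionals on the
functions on finite powers of `G`. -/
lemma FamilyRing.exists_functional [Nonempty Γ]
    (Λ : ∀ n : ℕ, (Fin (n + 1) → Γ) → Coord O H (n + 1) →ₗ[O] A)
    (hΛ : ∀ (m n : ℕ) (ζ : Fin (m + 1) → Fin (n + 1)) (f : Coord O H (m + 1))
      (γ : Fin (n + 1) → Γ), Λ n γ (reindexHom ζ f) = Λ m (fun j => γ (ζ j)) f) :
    ∃ l : FamilyRing O H Γ →ₗ[O] A, ∀ (n : ℕ) (γ : Fin (n + 1) → Γ) (f : Coord O H (n + 1)),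
      l (evalAt (fun i => familyPt (γ i)) f) = Λ n γ f := by
  -- The functional is well defined on values: two presentations of the same element are reindexed
  -- to one tuple of distinct elements, where the value determines the function.
  have wd : ∀ {m n : ℕ} (γ : Fin (m + 1) → Γ) (f : Coord O H (m + 1)) (δ : Fin (n + 1) → Γ)
      (f' : Coord O H (n + 1)), evalAt (fun i => familyPt (O := O) (H := H) (γ i)) f =
        evalAt (fun i => familyPt (δ i)) f' → Λ m γ f = Λ n δ f' := by
    intro m n γ f δ f' h
    obtain ⟨k, ε, ζ, ξ, hε, hζ, hξ⟩ := exists_injective_tuple γ δ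
    have h' : reindexHom ζ f = reindexHom ξ f' :=
      evalAt_familyPt_injective hε (by simpa [evalAt_reindexHom, hζ, hξ] using h)
    have h1 := hΛ m k ζ f ε
    rw [h', hΛ n k ξ f' ε] at h1
    simpa [hζ, hξ] using h1.symm
  choose n γ f hf using FamilyRing.exists_evalAt (O := O) (H := H) (Γ := Γ)
  let l : FamilyRing O H Γ → A := fun b => Λ (n b) (γ b) (f b)
  have hl : ∀ (n : ℕ) (γ : Fin (n + 1) → Γ) (f : Coord O H (n + 1)),
      l (evalAt (fun i => familyPt (γ i)) f) = Λ n γ f := fun n γ f => wd _ _ _ _ (hf _)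
  refine ⟨⟨⟨l, fun a b => ?_⟩, fun c a => ?_⟩, hl⟩
  · obtain ⟨n, γ, f, f', rfl, rfl⟩ := exists_common_tuple familyPt
      (FamilyRing.exists_evalAt a) (FamilyRing.exists_evalAt b)
    rw [← map_add, hl, hl, hl, map_add]
  · obtain ⟨n, γ, f, rfl⟩ := FamilyRing.exists_evalAt a
    change l _ = c • l _
    rw [← map_smul, hl, hl, map_smul]

end Family

/-! ### Representations and pseudocharacters with prescribed values -/

section Prescribed

variable {O H Γ : Type u} [CommRing O] [CommRing H] [HopfAlgebra O H] [Group Γ]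

/-- `ρ(γ)` takes the value `c` at the function `h` on `G`, for all `(γ, h, c) ∈ W`. -/
def RepHasValues (W : Set (Γ × H × O)) {A : Type u} [CommRing A] [Algebra O A]
    (ρ : Γ →* Pt O H A) : Prop :=
  ∀ x ∈ W, (ρ x.1).ofConv x.2.1 = algebraMap O A x.2.2

/-- `Θ₁(h)(γ) = c` for all `(γ, h, c) ∈ W` with `h` invariant. -/
def PseudoCharHasValues (W : Set (Γ × H × O)) {A : Type u} [CommRing A] [Algebra O A]
    (T : PseudoChar O H Γ A) : Prop :=
  ∀ x ∈ W, ∀ hx : (coordPt (O := O) (H := H) (n := 1) 0).ofConv x.2.1 ∈ invariants O H 1,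
    T.Θ 0 ⟨_, hx⟩ (fun _ => x.1) = algebraMap O A x.2.2

/-- `(R, ρ)` represents the functor of representations with values prescribed by `W`. -/
def IsUniversalRepWith (W : Set (Γ × H × O)) {R : Type u} [CommRing R] [Algebra O R]
    (ρ : Γ →* Pt O H R) : Prop :=
  RepHasValues W ρ ∧
  ∀ (A : Type u) [CommRing A] [Algebra O A] (σ : Γ →* Pt O H A), RepHasValues W σ →
    ∃! φ : R →ₐ[O] A, (Pt.map φ).comp ρ = σ

/-- `(P, T)` represents the functor of pseudocharacters with values prescribed by `W`. -/
def IsUniversalPseudoCharWith (W : Set (Γ × H × O)) {P : Type u} [CommRing P] [Algebra O P]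
    (T : PseudoChar O H Γ P) : Prop :=
  PseudoCharHasValues W T ∧
  ∀ (A : Type u) [CommRing A] [Algebra O A] (S : PseudoChar O H Γ A), PseudoCharHasValues W S →
    ∃! φ : P →ₐ[O] A, T.map φ = S

variable (W : Set (Γ × H × O))

/-- The relations expressing that a family of points is a representation with values prescribed
by `W`. -/
def repIdeal : Ideal (FamilyRing O H Γ) :=
  Ideal.span ({x | ∃ γ γ' h, x = (familyPt (γ * γ')).ofConv h -
      (familyPt γ * familyPt γ').ofConv h} ∪
    {x | ∃ w ∈ W, x = (familyPt w.1).ofConv w.2.1 - algebraMap O _ w.2.2})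

/-- The coordinate ring of the scheme of representations with values prescribed by `W`. -/
def RepRing : Type u := FamilyRing O H Γ ⧸ repIdeal W

instance : CommRing (RepRing W) := inferInstanceAs (CommRing (FamilyRing O H Γ ⧸ repIdeal W))

instance : Algebra O (RepRing W) := inferInstanceAs (Algebra O (FamilyRing O H Γ ⧸ repIdeal W))

/-- The projection from the coordinate ring of the scheme of families of points. -/
def RepRing.mk : FamilyRing O H Γ →ₐ[O] RepRing W := Ideal.Quotient.mkₐ O (repIdeal W)

lemma RepRing.mk_surjective : Function.Surjective (RepRing.mk W) := Ideal.Quotient.mk_surjective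

lemma RepRing.mk_eq_iff {x y : FamilyRing O H Γ} :
    RepRing.mk W x = RepRing.mk W y ↔ x - y ∈ repIdeal W :=
  Ideal.Quotient.eq

/-- The universal representation with values prescribed by `W`. -/
def univRep : Γ →* Pt O H (RepRing W) :=
  MonoidHom.mk' (fun γ => Pt.map (RepRing.mk W) (familyPt γ)) fun γ γ' => by
    rw [← map_mul]
    refine WithConv.ext (AlgHom.ext fun h => ?_)
    exact (RepRing.mk_eq_iff W).mpr (Ideal.subset_span (Or.inl ⟨γ, γ', h, rfl⟩))

lemma univRep_apply (γ : Γ) : univRep W γ = Pt.map (RepRing.mk W) (familyPt γ) := rfl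

theorem isUniversalRepWith_univRep : IsUniversalRepWith W (univRep W) := by
  refine ⟨fun x hx => ?_, fun A _ _ σ hσ => ?_⟩
  · exact ((RepRing.mk_eq_iff W).mpr (Ideal.subset_span (Or.inr ⟨x, hx, rfl⟩))).trans
      (AlgHom.commutes _ _)
  · have hval : ∀ γ h, familyLift σ ((familyPt (O := O) (H := H) γ).ofConv h) =
        (σ γ).ofConv h := fun γ h =>
      congrArg (fun g => g.ofConv h) (map_familyLift σ γ)
    have hker : repIdeal W ≤ RingHom.ker (familyLift σ) := by
      refine Ideal.span_le.mpr ?_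
      rintro _ (⟨γ, γ', h, rfl⟩ | ⟨x, hx, rfl⟩)
      · have h1 : familyLift σ ((familyPt γ * familyPt γ' :
            Pt O H (FamilyRing O H Γ)).ofConv h) = (σ γ * σ γ').ofConv h := by
          rw [← map_familyLift σ γ, ← map_familyLift σ γ', ← map_mul]
          rfl
        rw [SetLike.mem_coe, RingHom.mem_ker, map_sub, hval, h1, map_mul, sub_self]
      · rw [SetLike.mem_coe, RingHom.mem_ker, map_sub, hval, AlgHom.commutes, hσ x hx, sub_self]
    let φ : RepRing W →ₐ[O] A :=
      Ideal.Quotient.liftₐ (repIdeal W) (familyLift σ) fun x hx => hker hx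
    refine ⟨φ, ?_, ?_⟩
    · ext1 γ
      exact map_familyLift σ γ
    · rintro ψ rfl
      refine Ideal.Quotient.algHom_ext _ (family_hom_ext fun γ => ?_)
      exact (map_familyLift (fun δ => Pt.map ψ (univRep W δ)) γ).symm

variable {W}

/-! ### Linear functionals on the coordinate ring of representations -/

section Functional

variable {A : Type u} [CommRing A] [Algebra O A]

/-- The function `(g₁, …, gₙ₊₁) ↦ f(g₁, …, gₙ) h(gₙ₊₁)`. -/
def snocMul {n : ℕ} (f : Coord O H n) (h : H) : Coord O H (n + 1) :=
  reindexHom Fin.castSucc f * (coordPt (O := O) (H := H) (Fin.last n)).ofConv h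

lemma evalAt_snocMul {n : ℕ} (f : Coord O H n) (h : H) (g : Fin (n + 1) → Pt O H A) :
    evalAt g (snocMul f h) =
      evalAt (fun i => g i.castSucc) f * (g (Fin.last n)).ofConv h := by
  rw [snocMul, map_mul, evalAt_reindexHom, evalAt_coordPt_apply]

lemma mulLast_snoc_snoc {M : Type*} [Mul M] {n : ℕ} (γ : Fin n → M) (a b : M) :
    mulLast (Fin.snoc (α := fun _ => M) (Fin.snoc (α := fun _ => M) γ a) b) =
      Fin.snoc (α := fun _ => M) γ (a * b) := by
  simp [mulLast]

/-- A compatible family of functionals on the functions on finite powers of `G` induces a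
functional on the coordinate ring of the scheme of representations. -/
lemma RepRing.exists_functional
    (Λ : ∀ n : ℕ, (Fin (n + 1) → Γ) → Coord O H (n + 1) →ₗ[O] A)
    (hreindex : ∀ (m n : ℕ) (ζ : Fin (m + 1) → Fin (n + 1)) (f : Coord O H (m + 1))
      (γ : Fin (n + 1) → Γ), Λ n γ (reindexHom ζ f) = Λ m (fun j => γ (ζ j)) f)
    (hhat : ∀ (n : ℕ) (f : Coord O H (n + 1)) (γ : Fin (n + 2) → Γ),
      Λ (n + 1) γ (hatHom n f) = Λ n (mulLast γ) f)
    (hW : ∀ (n : ℕ) (f : Coord O H (n + 1)) (γ : Fin (n + 1) → Γ), ∀ w ∈ W,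
      Λ (n + 1) (Fin.snoc (α := fun _ => Γ) γ w.1) (snocMul f w.2.1) = w.2.2 • Λ n γ f) :
    ∃ l : RepRing W →ₗ[O] A, ∀ (n : ℕ) (γ : Fin (n + 1) → Γ) (f : Coord O H (n + 1)),
      l (evalAt (fun i => univRep W (γ i)) f) = Λ n γ f := by
  obtain ⟨l, hl⟩ := FamilyRing.exists_functional Λ hreindex
  have hsnoc : ∀ (n : ℕ) (γ : Fin (n + 1) → Γ) (γ' : Γ) (f : Coord O H (n + 1)) (h : H),
      evalAt (fun i => familyPt (γ i)) f * (familyPt γ').ofConv h =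
        evalAt (fun i => familyPt (Fin.snoc (α := fun _ => Γ) γ γ' i)) (snocMul f h) := by
    intro n γ γ' f h
    simp [evalAt_snocMul]
  -- Allowing an arbitrary multiplier `b` reduces the claim to generators of the ideal. Writing `b`
  -- as a value `f(δ)`, its product with a generator is a difference of values of functions on
  -- longer tuples, killed by `hhat` for the homomorphism relations and by `hW` for the prescribed
  -- values.
  have hkill : ∀ x ∈ repIdeal W, ∀ b, l (b * x) = 0 := by
    intro x hx
    refine Submodule.span_induction ?_ (fun b => by simp)
      (fun x y _ _ hx hy b => by rw [mul_add, map_add, hx, hy, add_zero])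
      (fun a x _ hx b => by rw [smul_eq_mul, ← mul_assoc, hx]) hx
    rintro _ (⟨γ, γ', h, rfl⟩ | ⟨w, hw, rfl⟩) b <;>
      obtain ⟨n, δ, f, rfl⟩ := FamilyRing.exists_evalAt b
    · have h1 : evalAt (fun i => familyPt (δ i)) f * (familyPt γ * familyPt γ').ofConv h =
          evalAt (fun i => familyPt (Fin.snoc (α := fun _ => Γ)
            (Fin.snoc (α := fun _ => Γ) δ γ) γ' i)) (hatHom (n + 1) (snocMul f h)) := by
        rw [evalAt_hatHom, evalAt_snocMul]
        simp [mulLast]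
      rw [mul_sub, map_sub, hsnoc, h1, hl, hl, hhat, mulLast_snoc_snoc, sub_self]
    · rw [mul_sub, map_sub, hsnoc, hl, hW _ _ _ w hw, mul_comm, ← Algebra.smul_def, map_smul, hl,
        sub_self]
  let p : FamilyRing O H Γ →ₗ[O] RepRing W := (RepRing.mk W).toLinearMap
  have hp : Function.Surjective p := RepRing.mk_surjective W
  refine ⟨(LinearMap.ker p).liftQ l (fun x hx => ?_) ∘ₗ
    (p.quotKerEquivOfSurjective hp).symm.toLinearMap, fun n γ f => ?_⟩
  · have hx' : RepRing.mk W x = RepRing.mk W 0 := (LinearMap.mem_ker.mp hx).trans (map_zero _).symm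
    have := hkill x (by simpa using (RepRing.mk_eq_iff W).mp hx') 1
    rwa [one_mul] at this
  · have h1 : evalAt (fun i => univRep W (γ i)) f = p (evalAt (fun i => familyPt (γ i)) f) :=
      (apply_evalAt (RepRing.mk W) _ f).symm
    have h2 : (p.quotKerEquivOfSurjective hp).symm (p (evalAt (fun i => familyPt (γ i)) f)) =
        Submodule.Quotient.mk (evalAt (fun i => familyPt (γ i)) f) :=
      (LinearEquiv.symm_apply_eq _).mpr rfl
    rw [h1, LinearMap.comp_apply, LinearEquiv.coe_coe, h2]
    exact hl n γ f

end Functional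

variable {R : Type u} [CommRing R] [Algebra O R] {ρ : Γ →* Pt O H R}

lemma IsUniversalRepWith.exists_hom (hρ : IsUniversalRepWith W ρ) {A : Type u} [CommRing A]
    [Algebra O A] {σ : Γ →* Pt O H A} (hσ : RepHasValues W σ) :
    ∃ φ : R →ₐ[O] A, ∀ γ, Pt.map φ (ρ γ) = σ γ := by
  obtain ⟨φ, hφ, -⟩ := hρ.2 A σ hσ
  exact ⟨φ, fun γ => congrArg (fun τ => τ γ) hφ⟩

/-- The claim holds for `RepRing W`, a quotient of `FamilyRing`, and passes to `R` because the
classifying maps compose to the identity of `R`. -/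
lemma IsUniversalRepWith.exists_evalAt (hρ : IsUniversalRepWith W ρ) (r : R) :
    ∃ (n : ℕ) (γ : Fin (n + 1) → Γ) (f : Coord O H (n + 1)),
      evalAt (fun i => ρ (γ i)) f = r := by
  obtain ⟨α, hα⟩ := (isUniversalRepWith_univRep W).exists_hom hρ.1
  obtain ⟨β, hβ⟩ := hρ.exists_hom (isUniversalRepWith_univRep W).1
  have hαβ : α.comp β = AlgHom.id O R := by
    refine (hρ.2 R ρ hρ.1).unique ?_ rfl
    ext1 γ
    rw [MonoidHom.comp_apply, ← Pt.map_comp_apply, hβ, hα]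
  obtain ⟨b, hb⟩ := RepRing.mk_surjective W (β r)
  obtain ⟨n, γ, f, rfl⟩ := FamilyRing.exists_evalAt b
  refine ⟨n, γ, f, ?_⟩
  have h := apply_evalAt (α.comp (RepRing.mk W))
    (fun i => familyPt (γ i)) f
  simp only [← Pt.map_comp_apply, ← univRep_apply, hα] at h
  rw [← h]
  exact (congrArg α hb).trans (congrArg (fun ψ => ψ r) hαβ)

lemma evalAt_mem_repInvariants (ρ : Γ →* Pt O H R) {n : ℕ} (γ : Fin n → Γ) {f : Coord O H n}
    (hf : f ∈ invariants O H n) : evalAt (fun i => ρ (γ i)) f ∈ repInvariants ρ := by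
  intro A _ _ h hh φ φ' e
  rw [apply_evalAt, apply_evalAt]
  simp only [e]
  exact hf A h hh _

/-- The pseudocharacter of `ρ`, with values in the ring of invariants. -/
def invPseudoChar (ρ : Γ →* Pt O H R) : PseudoChar O H Γ (repInvariants ρ) where
  Θ n := AlgHom.pi fun γ => ((evalAt fun i => ρ (γ i)).comp
    (invariants O H (n + 1)).val).codRestrict (repInvariants ρ)
      fun f => evalAt_mem_repInvariants ρ γ f.2
  reindex m n ζ f γ := Subtype.ext ((PseudoChar.ofRep ρ).reindex m n ζ f γ)
  hat n f γ := Subtype.ext ((PseudoChar.ofRep ρ).hat n f γ)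

lemma invPseudoChar_apply (ρ : Γ →* Pt O H R) (n : ℕ) (f : invariants O H (n + 1))
    (γ : Fin (n + 1) → Γ) :
    ((invPseudoChar ρ).Θ n f γ : R) = evalAt (fun i => ρ (γ i)) f.1 := rfl

lemma map_val_invPseudoChar (ρ : Γ →* Pt O H R) :
    (invPseudoChar ρ).map (repInvariants ρ).val = PseudoChar.ofRep ρ := rfl

lemma PseudoChar.map_comp {A B C : Type u} [CommRing A] [Algebra O A] [CommRing B] [Algebra O B]
    [CommRing C] [Algebra O C] (ψ : B →ₐ[O] C) (φ : A →ₐ[O] B) (T : PseudoChar O H Γ A) :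
    T.map (ψ.comp φ) = (T.map φ).map ψ := rfl

/-! ### The invariants represent pseudocharacters -/

section Universal

variable {T : Type u} [CommRing T] [HopfAlgebra O T] {q : H →ₐc[O] T} {I : T →ₗ[O] O}

/-- The conjugate of `ρ` by the universal point of the torus still has the prescribed values, since
these are values of invariant functions; universality then provides the morphism. -/
lemma IsUniversalRepWith.exists_coaction (hρ : IsUniversalRepWith W ρ) (hq : IsOntoNeutral q)
    (hW : ∀ w ∈ W, (coordPt (O := O) (H := H) (n := 1) 0).ofConv w.2.1 ∈ invariants O H 1) :
    ∃ φ : R →ₐ[O] R ⊗[O] T, ∀ γ, Pt.map φ (ρ γ) = torusConj q (ρ γ) := by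
  refine hρ.exists_hom (σ := MonoidHom.mk' (fun γ => torusConj q (ρ γ)) fun γ γ' => by
    rw [map_mul, torusConj_mul]) fun w hw => ?_
  have h := evalAt_torusConj_of_mem hq (hW w hw) (fun _ => ρ w.1)
  rw [evalAt_coordPt_apply, evalAt_coordPt_apply, hρ.1 w hw] at h
  exact h

/-- An invariant element `r` is sent to `r ⊗ 1` by the coaction, and integrating `r ⊗ 1` returns
`r`. Hence every invariant value is already a value of an invariant function. -/
lemma IsUniversalRepWith.evalAt_reynolds (hρ : IsUniversalRepWith W ρ) (hq : IsOntoNeutral q)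
    (hI : IsHaar I)
    (hW : ∀ w ∈ W, (coordPt (O := O) (H := H) (n := 1) 0).ofConv w.2.1 ∈ invariants O H 1) {n : ℕ}
    (γ : Fin n → Γ) (f : Coord O H n) (hf : evalAt (fun i => ρ (γ i)) f ∈ repInvariants ρ) :
    evalAt (fun i => ρ (γ i)) (reynolds q I n f) = evalAt (fun i => ρ (γ i)) f := by
  obtain ⟨φ, hφ⟩ := hρ.exists_coaction hq hW
  have h := hf (R ⊗[O] T) (torusPt q R) (torusPt_mem hq R) Algebra.TensorProduct.includeLeft φ hφ
  rw [apply_evalAt] at h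
  simp only [hφ] at h
  rw [GenTorus.evalAt_reynolds, avg_apply, h, Algebra.TensorProduct.includeLeft_apply,
    integrate_tmul, hI.map_one, one_smul]

/-- A pseudocharacter extends to a linear functional on the coordinate ring of the scheme of
representations. -/
lemma IsUniversalRepWith.exists_functional (hρ : IsUniversalRepWith W ρ) (hq : IsOntoNeutral q)
    (hI : IsHaar I)
    (hW : ∀ w ∈ W, (coordPt (O := O) (H := H) (n := 1) 0).ofConv w.2.1 ∈ invariants O H 1)
    {A : Type u} [CommRing A] [Algebra O A] (S : PseudoChar O H Γ A)
    (hS : PseudoCharHasValues W S) :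
    ∃ l : R →ₗ[O] A, ∀ (n : ℕ) (γ : Fin (n + 1) → Γ) (f : invariants O H (n + 1)),
      l (evalAt (fun i => ρ (γ i)) f.1) = S.Θ n f γ := by
  let E (n : ℕ) (f : Coord O H n) : invariants O H n :=
    ⟨reynolds q I n f, reynolds_mem hq hI f⟩
  have hE : ∀ {n : ℕ} (f : invariants O H n), E n f.1 = f := fun f =>
    Subtype.ext (reynolds_of_mem hq hI f.2)
  -- `S` is extended from invariant functions to all functions by averaging first; this keeps
  -- linearity but not multiplicativity.
  let Λ : ∀ n : ℕ, (Fin (n + 1) → Γ) → Coord O H (n + 1) →ₗ[O] A := fun n γ =>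
    { toFun f := S.Θ n (E (n + 1) f) γ
      map_add' f f' := by
        have : E (n + 1) (f + f') = E (n + 1) f + E (n + 1) f' := Subtype.ext (map_add _ _ _)
        rw [this, map_add, Pi.add_apply]
      map_smul' c f := by
        have : E (n + 1) (c • f) = c • E (n + 1) f := Subtype.ext (map_smul _ _ _)
        rw [this, map_smul, Pi.smul_apply, RingHom.id_apply] }
  obtain ⟨l, hl⟩ := RepRing.exists_functional (W := W) Λ
    (fun m n ζ f γ => by
      refine Eq.trans ?_ (S.reindex m n ζ (E (m + 1) f) γ)
      exact congrArg (fun x => S.Θ n x γ) (Subtype.ext (reynolds_reindexHom ζ f)))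
    (fun n f γ => by
      refine Eq.trans ?_ (S.hat n (E (n + 1) f) γ)
      exact congrArg (fun x => S.Θ (n + 1) x γ) (Subtype.ext (reynolds_hatHom f)))
    (fun n f γ w hw => by
      let v : invariants O H 1 := ⟨_, hW w hw⟩
      have h1 : (coordPt (O := O) (H := H) (Fin.last (n + 1))).ofConv w.2.1 =
          reindexHom (fun _ : Fin 1 => Fin.last (n + 1)) v.1 :=
        (evalAt_coordPt_apply (n := 1) (fun _ => coordPt (Fin.last (n + 1))) 0 w.2.1).symm
      -- The prescribed function is invariant, so it leaves the average; the remaining product is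
      -- then evaluated by multiplicativity of `S.Θ`.
      have h2 : E (n + 2) (snocMul f w.2.1) =
          ⟨reindexHom Fin.castSucc (E (n + 1) f).1, reindexHom_mem _ (E (n + 1) f).2⟩ *
          ⟨reindexHom (fun _ : Fin 1 => Fin.last (n + 1)) v.1, reindexHom_mem _ v.2⟩ := by
        refine Subtype.ext ?_
        change reynolds q I (n + 2) (snocMul f w.2.1) =
          reindexHom Fin.castSucc (reynolds q I (n + 1) f) *
            reindexHom (fun _ : Fin 1 => Fin.last (n + 1)) v.1
        rw [snocMul, h1, reynolds_mul_of_mem hq _ (reindexHom_mem _ v.2), reynolds_reindexHom]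
      change S.Θ (n + 1) (E (n + 2) (snocMul f w.2.1)) _ = w.2.2 • S.Θ n (E (n + 1) f) γ
      rw [h2, map_mul, Pi.mul_apply, S.reindex n (n + 1), S.reindex 0 (n + 1)]
      simp only [Fin.snoc_castSucc, Fin.snoc_last]
      rw [hS w hw, mul_comm, Algebra.smul_def])
  obtain ⟨β, hβ⟩ := hρ.exists_hom (isUniversalRepWith_univRep W).1
  refine ⟨l ∘ₗ β.toLinearMap, fun n γ f => ?_⟩
  rw [LinearMap.comp_apply, AlgHom.toLinearMap_apply, apply_evalAt]
  simp only [hβ]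
  rw [hl]
  exact congrArg (fun x => S.Θ n x γ) (hE f)

/-- The ring of invariants of the universal representation represents pseudocharacters. -/
theorem IsUniversalRepWith.isUniversalPseudoCharWith (hρ : IsUniversalRepWith W ρ)
    (hq : IsOntoNeutral q) (hI : IsHaar I)
    (hW : ∀ w ∈ W, (coordPt (O := O) (H := H) (n := 1) 0).ofConv w.2.1 ∈ invariants O H 1) :
    IsUniversalPseudoCharWith W (invPseudoChar ρ) := by
  refine ⟨fun w hw hv => Subtype.ext ?_, fun A _ _ S hS => ?_⟩
  · rw [invPseudoChar_apply, evalAt_coordPt_apply]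
    exact hρ.1 w hw
  -- Any two invariants are values of invariant functions at one common tuple. Multiplicativity of
  -- the functional and uniqueness of the classifying map both follow from this.
  · have hcommon : ∀ r s : repInvariants ρ, ∃ (n : ℕ) (γ : Fin (n + 1) → Γ)
        (f f' : invariants O H (n + 1)),
        (invPseudoChar ρ).Θ n f γ = r ∧ (invPseudoChar ρ).Θ n f' γ = s := by
      intro r s
      obtain ⟨n, γ, f, f', hf, hf'⟩ := exists_common_tuple ρ (hρ.exists_evalAt r.1)
        (hρ.exists_evalAt s.1)
      refine ⟨n, γ, ⟨_, reynolds_mem hq hI f⟩, ⟨_, reynolds_mem hq hI f'⟩, Subtype.ext ?_,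
        Subtype.ext ?_⟩
      · exact (hρ.evalAt_reynolds hq hI hW γ f (hf ▸ r.2)).trans hf
      · exact (hρ.evalAt_reynolds hq hI hW γ f' (hf' ▸ s.2)).trans hf'
    obtain ⟨l, hl⟩ := hρ.exists_functional hq hI hW S hS
    have hl' : ∀ n γ f, l ((invPseudoChar ρ).Θ n f γ : R) = S.Θ n f γ := fun n γ f => hl n γ f
    refine ⟨AlgHom.ofLinearMap (l ∘ₗ (repInvariants ρ).val.toLinearMap) ?_ ?_, ?_, ?_⟩
    · have := hl 0 (fun _ => 1) 1
      rw [OneMemClass.coe_one, map_one (evalAt _), map_one (S.Θ 0)] at this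
      exact this
    · intro r s
      obtain ⟨n, γ, f, f', rfl, rfl⟩ := hcommon r s
      have h := hl' n γ (f * f')
      rw [map_mul, map_mul, Pi.mul_apply, Pi.mul_apply, ← hl', ← hl'] at h
      exact h
    · refine PseudoChar.ext (funext fun n => AlgHom.ext fun f => funext fun γ => ?_)
      exact hl n γ f
    · rintro ψ rfl
      refine AlgHom.ext fun r => ?_
      obtain ⟨n, γ, f, -, rfl, -⟩ := hcommon r r
      exact (hl n γ f).symm

end Universal

end Prescribed

/-! ### Comparison of arbitrary representing objects -/

section Comparison

variable {O H Γ : Type u} [CommRing O] [CommRing H] [HopfAlgebra O H] [Group Γ]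
  {W : Set (Γ × H × O)}

lemma PseudoChar.map_id {A : Type u} [CommRing A] [Algebra O A] (T : PseudoChar O H Γ A) :
    T.map (AlgHom.id O A) = T := rfl

lemma IsUniversalPseudoCharWith.exists_equiv {P P' : Type u} [CommRing P] [Algebra O P]
    [CommRing P'] [Algebra O P'] {T : PseudoChar O H Γ P} {T' : PseudoChar O H Γ P'}
    (hT : IsUniversalPseudoCharWith W T) (hT' : IsUniversalPseudoCharWith W T') :
    ∃ e : P ≃ₐ[O] P', T.map e.toAlgHom = T' := by
  obtain ⟨φ, hφ, -⟩ := hT.2 P' T' hT'.1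
  obtain ⟨ψ, hψ, -⟩ := hT'.2 P T hT.1
  refine ⟨AlgEquiv.ofAlgHom φ ψ ?_ ?_, hφ⟩
  · refine (hT'.2 P' T' hT'.1).unique ?_ T'.map_id
    rw [PseudoChar.map_comp, hψ, hφ]
  · refine (hT.2 P T hT.1).unique ?_ T.map_id
    rw [PseudoChar.map_comp, hφ, hψ]

/-- Representability of representations and pseudocharacters with prescribed values at invariant
functions, and the comparison of the coordinate rings. -/
theorem representable_and_comparison (hG : IsGeneralisedTorus O H)
    (hW : ∀ w ∈ W, (coordPt (O := O) (H := H) (n := 1) 0).ofConv w.2.1 ∈ invariants O H 1) :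
    (∃ (R : Type u) (_ : CommRing R) (_ : Algebra O R) (ρ : Γ →* Pt O H R),
        IsUniversalRepWith W ρ) ∧
      (∃ (P : Type u) (_ : CommRing P) (_ : Algebra O P) (T : PseudoChar O H Γ P),
        IsUniversalPseudoCharWith W T) ∧
      ∀ (R : Type u) [CommRing R] [Algebra O R] (ρ : Γ →* Pt O H R)
        (P : Type u) [CommRing P] [Algebra O P] (T : PseudoChar O H Γ P),
        IsUniversalRepWith W ρ → IsUniversalPseudoCharWith W T →
        ∃ e : P ≃ₐ[O] repInvariants ρ,
          T.map ((repInvariants ρ).val.comp e.toAlgHom) = PseudoChar.ofRep ρ := by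
  obtain ⟨D, _, _, q, hD, hq⟩ := hG.torus
  obtain ⟨I, hI⟩ := hD.exists_isHaar
  have huniv : ∀ (R : Type u) [CommRing R] [Algebra O R] (ρ : Γ →* Pt O H R),
      IsUniversalRepWith W ρ → IsUniversalPseudoCharWith W (invPseudoChar ρ) :=
    fun R _ _ ρ hρ => hρ.isUniversalPseudoCharWith (fun A _ _ => (hq A).2) hI hW
  refine ⟨⟨_, _, _, _, isUniversalRepWith_univRep W⟩,
    ⟨_, _, _, _, huniv _ _ (isUniversalRepWith_univRep W)⟩, fun R _ _ ρ P _ _ T hρ hT => ?_⟩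
  obtain ⟨e, he⟩ := hT.exists_equiv (huniv R ρ hρ)
  exact ⟨e, by rw [PseudoChar.map_comp, he, map_val_invPseudoChar]⟩

lemma isUniversalRepWith_empty_iff {R : Type u} [CommRing R] [Algebra O R] {ρ : Γ →* Pt O H R} :
    IsUniversalRepWith ∅ ρ ↔ IsUniversalRep ρ := by
  simp [IsUniversalRepWith, IsUniversalRep, RepHasValues]

lemma isUniversalPseudoCharWith_empty_iff {P : Type u} [CommRing P] [Algebra O P]
    {T : PseudoChar O H Γ P} : IsUniversalPseudoCharWith ∅ T ↔ IsUniversalPseudoChar T := by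
  simp [IsUniversalPseudoCharWith, IsUniversalPseudoChar, PseudoCharHasValues]

end Comparison

/-! ### Admissibility -/

section Admissible

variable {O H Γ Δ : Type u} [CommRing O] [CommRing H] [HopfAlgebra O H] [Group Γ]
  [Group Δ] [Fintype Δ] [DecidableEq Δ] {A : Type u} [CommRing A] [Algebra O A]

/-- The idempotent `ind O 1` cuts out a clopen set containing the identity section, and a connected
component of a fibre that meets a clopen set lies inside it. -/
lemma ConstCoord.ind_notMem_of_mem_neutralLocus {x : PrimeSpectrum (ConstCoord O Δ)}
    (hx : x ∈ neutralLocus O (ConstCoord O Δ)) : ConstCoord.ind O (1 : Δ) ∉ x.asIdeal := by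
  have hidem : IsIdempotentElem (ConstCoord.ind O (1 : Δ)) := by
    simp [IsIdempotentElem, ConstCoord.ind_mul_ind]
  have hclopen := PrimeSpectrum.isClopen_iff.mpr ⟨_, hidem, rfl⟩
  set e := PrimeSpectrum.comap (Bialgebra.counitAlgHom O (ConstCoord O Δ)).toRingHom
    (PrimeSpectrum.comap (algebraMap O (ConstCoord O Δ)) x)
  set F := PrimeSpectrum.comap (algebraMap O (ConstCoord O Δ)) ⁻¹'
    {PrimeSpectrum.comap (algebraMap O (ConstCoord O Δ)) x}
  have hmem : x ∈ connectedComponentIn F e := hx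
  have heF : e ∈ F := connectedComponentIn_nonempty_iff.mp ⟨x, hmem⟩
  have he : e ∈ (PrimeSpectrum.basicOpen (ConstCoord.ind O (1 : Δ)) : Set _) := by
    change ¬ (Bialgebra.counitAlgHom O (ConstCoord O Δ)) (ConstCoord.ind O (1 : Δ)) ∈
      (PrimeSpectrum.comap (algebraMap O (ConstCoord O Δ)) x).asIdeal
    have : Bialgebra.counitAlgHom O (ConstCoord O Δ) (ConstCoord.ind O (1 : Δ)) = 1 :=
      (ConstCoord.ev_ind 1 1).trans (if_pos rfl)
    rw [this]
    exact (Ideal.ne_top_iff_one _).mp (PrimeSpectrum.isPrime _).ne_top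
  exact isPreconnected_connectedComponentIn.subset_isClopen hclopen
    ⟨e, mem_connectedComponentIn heF, he⟩ hmem

/-- The neutral component of a constant group scheme is trivial. -/
lemma ConstCoord.eq_one_of_mem_neutralPt {g : Pt O (ConstCoord O Δ) A} (hg : g ∈ neutralPt A) :
    g = 1 := by
  have hidem : IsIdempotentElem (g.ofConv (ConstCoord.ind O (1 : Δ))) := by
    rw [IsIdempotentElem, ← map_mul, ConstCoord.ind_mul_ind, if_pos rfl]
  -- The idempotent lies in no maximal ideal of `A`, so it is a unit and equals `1`; orthogonality
  -- then kills the other indicators.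
  have hunit : IsUnit (g.ofConv (ConstCoord.ind O (1 : Δ))) := by
    by_contra h
    obtain ⟨M, hM, hmem⟩ := exists_max_ideal_of_mem_nonunits h
    exact ConstCoord.ind_notMem_of_mem_neutralLocus (hg ⟨M, hM.isPrime⟩) hmem
  have h1 : g.ofConv (ConstCoord.ind O (1 : Δ)) = 1 :=
    (IsIdempotentElem.iff_eq_one_of_isUnit hunit).mp hidem
  refine WithConv.ext (ConstCoord.algHom_ext fun δ => ?_)
  have h2 : (1 : Pt O (ConstCoord O Δ) A).ofConv (ConstCoord.ind O δ) =
      algebraMap O A (ConstCoord.ev O 1 (ConstCoord.ind O δ)) := rfl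
  rw [h2, ConstCoord.ev_ind]
  by_cases h : 1 = δ
  · subst h
    rw [h1, if_pos rfl, map_one]
  · rw [if_neg h, map_zero, ← one_mul (g.ofConv _), ← h1, ← map_mul, ConstCoord.ind_mul_ind,
      if_neg h, map_zero]

lemma ConstCoord.mem_invariants {n : ℕ} (f : Coord O (ConstCoord O Δ) n) :
    f ∈ invariants O (ConstCoord O Δ) n := by
  intro A _ _ h hh g
  simp [ConstCoord.eq_one_of_mem_neutralPt hh]

variable (p : ConstCoord O Δ →ₐc[O] H) (π : Γ →* Δ)

/-- The values that characterise admissible representations. -/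
def admissibleValues : Set (Γ × H × O) :=
  Set.range fun x : Γ × ConstCoord O Δ => (x.1, p x.2, ConstCoord.ev O (π x.1) x.2)

lemma pullHom_coordPt {n : ℕ} (i : Fin n) (c : ConstCoord O Δ) :
    pullHom p n ((coordPt (O := O) (H := ConstCoord O Δ) i).ofConv c) =
      (coordPt (O := O) (H := H) i).ofConv (p c) :=
  evalAt_coordPt_apply _ i c

/-- Functions pulled back from `Δ` are invariant because `G⁰` maps to the trivial neutral component
of the constant group scheme. -/
lemma admissibleValues_mem_invariants : ∀ w ∈ admissibleValues p π,
    (coordPt (O := O) (H := H) (n := 1) 0).ofConv w.2.1 ∈ invariants O H 1 := by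
  rintro _ ⟨⟨γ, c⟩, rfl⟩
  rw [← pullHom_coordPt]
  exact pullHom_mem p (ConstCoord.mem_invariants _)

lemma repHasValues_admissible_iff {ρ : Γ →* Pt O H A} :
    RepHasValues (admissibleValues p π) ρ ↔ IsAdmissibleRep p π ρ := by
  constructor
  · intro h
    ext1 γ
    refine WithConv.ext (AlgHom.ext fun c => ?_)
    exact h _ ⟨(γ, c), rfl⟩
  · rintro h _ ⟨⟨γ, c⟩, rfl⟩
    exact congrArg (fun σ => (σ γ).ofConv c) h

/-- Every function on `Δⁿ` is invariant, so the image of `T` is given by algebra maps on full tensor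
powers. These are determined on single coordinates, where reindexing reduces everything to `Θ₁`. -/
lemma pseudoCharHasValues_admissible_iff {T : PseudoChar O H Γ A} :
    PseudoCharHasValues (admissibleValues p π) T ↔ IsAdmissiblePseudoChar p π T := by
  constructor
  · intro h
    refine PseudoChar.ext (funext fun n => AlgHom.ext fun f => funext fun γ => ?_)
    let φ : Coord O (ConstCoord O Δ) (n + 1) →ₐ[O] A :=
      (Pi.evalAlgHom O (fun _ => A) γ).comp ((T.Θ n).comp
        ((pullHom p (n + 1)).codRestrict (invariants O H (n + 1)) fun f =>
          pullHom_mem p (ConstCoord.mem_invariants f)))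
    have hφ : φ = evalAt fun i => ConstCoord.point A (π (γ i)) := by
      apply PiTensorProduct.algHom_ext
      intro i
      rw [evalAt_single]
      refine AlgHom.ext fun c => ?_
      have hw := admissibleValues_mem_invariants p π _ ⟨(γ i, c), rfl⟩
      refine Eq.trans ?_ ((T.reindex 0 n (fun _ => i) ⟨_, hw⟩ γ).trans (h _ ⟨(γ i, c), rfl⟩ hw))
      refine congrArg (fun x => T.Θ n x γ) (Subtype.ext ?_)
      exact (pullHom_coordPt p i c).trans
        (evalAt_coordPt_apply (n := 1) (fun _ => coordPt i) 0 (p c)).symm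
    exact congrArg (fun ψ => ψ f.1) hφ
  · rintro h _ ⟨⟨γ, c⟩, rfl⟩ hw
    let f : invariants O (ConstCoord O Δ) 1 :=
      ⟨(coordPt (O := O) (H := ConstCoord O Δ) (n := 1) 0).ofConv c, ConstCoord.mem_invariants _⟩
    have h1 := congrArg (fun S : PseudoChar O (ConstCoord O Δ) Γ A => S.Θ 0 f fun _ => γ) h
    refine Eq.trans ?_ (h1.trans (evalAt_coordPt_apply _ 0 c))
    exact congrArg (fun x => T.Θ 0 x fun _ => γ) (Subtype.ext (pullHom_coordPt p 0 c).symm)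

lemma isUniversalRepWith_admissible_iff {R : Type u} [CommRing R] [Algebra O R]
    {ρ : Γ →* Pt O H R} :
    IsUniversalRepWith (admissibleValues p π) ρ ↔ IsUniversalAdmissibleRep p π ρ := by
  simp only [IsUniversalRepWith, IsUniversalAdmissibleRep, repHasValues_admissible_iff]

lemma isUniversalPseudoCharWith_admissible_iff {P : Type u} [CommRing P] [Algebra O P]
    {T : PseudoChar O H Γ P} :
    IsUniversalPseudoCharWith (admissibleValues p π) T ↔
      IsUniversalAdmissiblePseudoChar p π T := by
  simp only [IsUniversalPseudoCharWith, IsUniversalAdmissiblePseudoChar,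
    pseudoCharHasValues_admissible_iff]

end Admissible

end

end GenTorus

theorem mainTheorem5 (O H Γ : Type u) [CommRing O] [CommRing H] [HopfAlgebra O H] [Group Γ]
    (hG : GenTorus.IsGeneralisedTorus O H) :
    -- the functors `Rep` and `PC` are representable
    ((∃ (R : Type u) (_ : CommRing R) (_ : Algebra O R) (ρ : Γ →* GenTorus.Pt O H R),
        GenTorus.IsUniversalRep ρ) ∧
      (∃ (P : Type u) (_ : CommRing P) (_ : Algebra O P) (T : GenTorus.PseudoChar O H Γ P),
        GenTorus.IsUniversalPseudoChar T) ∧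
      -- and `ρ ↦ Θ_ρ` induces an isomorphism from `𝒪(PC)` onto `𝒪(Rep)^{G⁰}`
      ∀ (R : Type u) [CommRing R] [Algebra O R] (ρ : Γ →* GenTorus.Pt O H R)
        (P : Type u) [CommRing P] [Algebra O P] (T : GenTorus.PseudoChar O H Γ P),
        GenTorus.IsUniversalRep ρ → GenTorus.IsUniversalPseudoChar T →
        ∃ e : P ≃ₐ[O] GenTorus.repInvariants ρ,
          T.map ((GenTorus.repInvariants ρ).val.comp e.toAlgHom) = GenTorus.PseudoChar.ofRep ρ) ∧
    -- the same for the admissible loci, when `G/G⁰` is the constant group scheme of `Δ`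
    ∀ (Δ : Type u) [Group Δ] [Fintype Δ] [DecidableEq Δ]
      (p : GenTorus.ConstCoord O Δ →ₐc[O] H),
      GenTorus.IsComponentQuotient (p : GenTorus.ConstCoord O Δ →ₐ[O] H) → ∀ π : Γ →* Δ,
      (∃ (R : Type u) (_ : CommRing R) (_ : Algebra O R) (ρ : Γ →* GenTorus.Pt O H R),
        GenTorus.IsUniversalAdmissibleRep p π ρ) ∧
      (∃ (P : Type u) (_ : CommRing P) (_ : Algebra O P) (T : GenTorus.PseudoChar O H Γ P),
        GenTorus.IsUniversalAdmissiblePseudoChar p π T) ∧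
      ∀ (R : Type u) [CommRing R] [Algebra O R] (ρ : Γ →* GenTorus.Pt O H R)
        (P : Type u) [CommRing P] [Algebra O P] (T : GenTorus.PseudoChar O H Γ P),
        GenTorus.IsUniversalAdmissibleRep p π ρ →
        GenTorus.IsUniversalAdmissiblePseudoChar p π T →
        ∃ e : P ≃ₐ[O] GenTorus.repInvariants ρ,
          T.map ((GenTorus.repInvariants ρ).val.comp e.toAlgHom) = GenTorus.PseudoChar.ofRep ρ := by
  -- Part (a) is the case `W = ∅`; part (b) is the case `W = admissibleValues p π`.
  refine ⟨?_, fun Δ _ _ _ p _ π => ?_⟩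
  · simpa only [GenTorus.isUniversalRepWith_empty_iff,
      GenTorus.isUniversalPseudoCharWith_empty_iff] using
        GenTorus.representable_and_comparison (Γ := Γ) (W := ∅) hG (by simp)
  · simpa only [GenTorus.isUniversalRepWith_admissible_iff,
      GenTorus.isUniversalPseudoCharWith_admissible_iff] using
        GenTorus.representable_and_comparison hG (GenTorus.admissibleValues_mem_invariants p π)
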